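/- Let $G$ be a reductive algebraic group over $\mathbb{Q}$, i.e. an affine algebraic group over $\mathbb{Q}$ all of whose finite-dimensional rational representations are completely reducible, and let $w:\mathbb{G}_m\to G$ be an injective central cocharacter. For a (possibly infinite-dimensional) rational representation $V$ of $G$ and $r\in\mathbb{Z}$, the part of $V$ of Adams degree $r$ is $V\langle r\rangle=\{x\in V: w(\lambda)x=\lambda^{-r}x\}$. A *cdga over $G$* is a $\mathbb{Z}$-graded complex $(A^*,d)$ of representations of $G$, $d:A^n\to A^{n+1}$, with a unital, associative, graded commutative multiplication $A^*\otimes A^*\to A^*$ that is $G$-equivariant and satisfies $d(ab)=da\cdot b+(-1)^n a\cdot db$ for $a\in A^n$, such that the trivial representation $\mathbb{Q}=\mathbb{Q}\cdot 1$ is a direct summand of the complex of representations $A^*\langle 0\rangle$. It is *cohomologically connected* if $H^n(A)=0$ for $n<0$ and the unit induces $\mathbb{Q}\cong H^0(A)$; it is *Adams connected* if $A\langle r\rangle=0$ for $r<0$ and $A\langle 0\rangle=\mathbb{Q}$. A map of cdgas over $G$ is a $G$-equivariant homomorphism of graded algebras commuting with $d$. For a cdga $A$ over $G$ and $n\ge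 0$ let $A\langle\langle n\rangle\rangle$ be the subalgebra generated by the elements of cohomological degree $\le n$; put $A\langle\langle n+1,0\rangle\rangle=A\langle\langle n\rangle\rangle$ and, for $q\ge 0$, let $A\langle\langle n+1,q+1\rangle\rangle$ be the subalgebra generated by $A\langle\langle n\rangle\rangle$ and all $x\in A\langle\langle n+1\rangle\rangle$ of degree $n+1$ with $dx\in A\langle\langle n+1,q\rangle\rangle$. Then $A$ is *generalized nilpotent* if (i) as a graded algebra with $G$-action $A=\mathrm{Sym}^*E$ is the free graded commutative algebra on a graded representation $E$ of $G$ concentrated in degrees $>0$, and (ii) $A\langle\langle n+1\rangle\rangle=\bigcup_{q\ge 0}A\langle\langle n+1,q\rangle\rangle$ for all $n\ge 0$. **Proposition.** Let $A$ be a cohomologically connected cdga over $G$. 1. For every integer $n\ge 1$ there is an $n$-minimal model of $A$, i.e. a map $s:A\{n\}\to A$ of cdgas over $G$ such that $A\{n\}$ is generalized nilpotent and generated as an algebra by its elements of degree $\le n$, and $s$ induces an isomorphism on $H^m$ for $1\le m\le n$ and an injection on $H^{n+1}$. 2. There is an $\infty$-minimal model of $A$, i.e. a map $s:A\{\infty\}\to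 A$ of cdgas over $G$ such that $A\{\infty\}$ is generalized nilpotent and $s$ is a quasi-isomorphism. If, moreover, $A$ is Adams connected, then the cdgas $A\{n\}$ and $A\{\infty\}$ in 1 and 2 can be taken to be Adams connected. -/

import Mathlib

open scoped TensorProduct DirectSum LaurentPolynomial

universe u v

noncomputable section

namespace CdgaOver

/-! ### Affine algebraic groups over `ℚ` and their rational representations

The affine group scheme `G = Spec H` is given by its coordinate ring, a commutative Hopf algebra
`H` over `ℚ`; it is algebraic when `H` is a finitely generated `ℚ`-algebra. A (rational, possibly
infinite-dimensional) representation of `G` on `V` is a right `H`-comodule structure on `V`. -/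

section Representations

variable {H : Type u} [CommRing H] [HopfAlgebra ℚ H]
variable {V : Type v} [AddCommGroup V] [Module ℚ V]

/-- `ρ : V → V ⊗ H` is a representation of `G = Spec H` on `V`. -/
structure IsRep (ρ : V →ₗ[ℚ] V ⊗[ℚ] H) : Prop where
  coassoc : (TensorProduct.assoc ℚ V H H).toLinearMap ∘ₗ ρ.rTensor H ∘ₗ ρ =
    (Coalgebra.comul (R := ℚ) (A := H)).lTensor V ∘ₗ ρ
  counit : (TensorProduct.rid ℚ V).toLinearMap ∘ₗ
    (Coalgebra.counit (R := ℚ) (A := H)).lTensor V ∘ₗ ρ = LinearMap.id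

/-- `W ⊆ V` is stable under `G`, i.e. `ρ W ⊆ W ⊗ H` inside `V ⊗ H`. -/
def IsSubrep (ρ : V →ₗ[ℚ] V ⊗[ℚ] H) (W : Submodule ℚ V) : Prop :=
  ∀ x ∈ W, ρ x ∈ LinearMap.range (W.subtype.rTensor H)

variable (H) in
/-- `G = Spec H` is reductive. Over a field of characteristic zero this means: every
finite-dimensional rational representation is completely reducible, i.e. every subrepresentation
has a complementary subrepresentation. -/
def IsReductive : Prop :=
  ∀ (V : Type) [AddCommGroup V] [Module ℚ V] [FiniteDimensional ℚ V]
    (ρ : V →ₗ[ℚ] V ⊗[ℚ] H), IsRep ρ →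
    ∀ W : Submodule ℚ V, IsSubrep ρ W → ∃ W' : Submodule ℚ V, IsSubrep ρ W' ∧ IsCompl W W'

variable (H) in
/-- An injective central cocharacter `w : 𝔾ₘ → G`, given by its map on coordinate rings. -/
structure CentralCocharacter where
  comorphism : H →ₐc[ℚ] ℚ[T;T⁻¹]
  /-- `w(t) g = g w(t)` -/
  central : TensorProduct.map (comorphism : H →ₗ[ℚ] ℚ[T;T⁻¹]) LinearMap.id ∘ₗ
      Coalgebra.comul (R := ℚ) (A := H) =
    TensorProduct.map (comorphism : H →ₗ[ℚ] ℚ[T;T⁻¹]) LinearMap.id ∘ₗ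
      (TensorProduct.comm ℚ H H).toLinearMap ∘ₗ Coalgebra.comul (R := ℚ) (A := H)
  /-- `w` is injective (a closed immersion) -/
  injective : Function.Surjective comorphism

/-- The weight `r` part `{x | w(t) x = t ^ r x}` of a representation. -/
def weightPart (w : CentralCocharacter H) (ρ : V →ₗ[ℚ] V ⊗[ℚ] H) (r : ℤ) : Submodule ℚ V :=
  LinearMap.eqLocus ((w.comorphism : H →ₗ[ℚ] ℚ[T;T⁻¹]).lTensor V ∘ₗ ρ)
    ((TensorProduct.mk ℚ V ℚ[T;T⁻¹]).flip (LaurentPolynomial.T r))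

/-- The Adams degree `r` part of a representation: the weight `-r` part. -/
def adamsPart (w : CentralCocharacter H) (ρ : V →ₗ[ℚ] V ⊗[ℚ] H) (r : ℤ) : Submodule ℚ V :=
  weightPart w ρ (-r)

end Representations

/-! ### Cdgas over `G` -/

/-- A commutative differential graded algebra over `G = Spec H`. The complex `A^*` is the internal
direct sum of its components `A^n = deg n`. That the unit and the multiplication are `G`-equivariant
is the statement that the coaction `ρ` is a homomorphism of algebras. (The decomposition of `A^*`
into the subcomplexes `adamsPart r` is automatic for a complex of representations.) -/
structure Cdga (H : Type u) [CommRing H] [HopfAlgebra ℚ H] where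
  carrier : Type v
  [ring : Ring carrier]
  [algebra : Algebra ℚ carrier]
  deg : ℤ → Submodule ℚ carrier
  [graded : GradedAlgebra deg]
  ρ : carrier →ₐ[ℚ] carrier ⊗[ℚ] H
  d : carrier →ₗ[ℚ] carrier
  graded_comm : ∀ (m n : ℤ), ∀ a ∈ deg m, ∀ b ∈ deg n, a * b = (m * n).negOnePow • (b * a)
  isRep : IsRep ρ.toLinearMap
  deg_subrep : ∀ n, IsSubrep ρ.toLinearMap (deg n)
  d_mem : ∀ n, ∀ a ∈ deg n, d a ∈ deg (n + 1)
  d_d : ∀ a, d (d a) = 0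
  d_equivariant : ρ.toLinearMap ∘ₗ d = d.rTensor H ∘ₗ ρ.toLinearMap
  leibniz : ∀ n : ℤ, ∀ a ∈ deg n, ∀ b, d (a * b) = d a * b + n.negOnePow • (a * d b)
  /-- The trivial representation `ℚ · 1`, in degree `0`, is a direct summand of the complex of
  representations: the unit has a retraction `ε : A^* → ℚ`. -/
  unit_split : ∃ ε : carrier →ₗ[ℚ] ℚ, ε 1 = 1 ∧ (∀ n, n ≠ 0 → ∀ a ∈ deg n, ε a = 0) ∧
    (∀ a, ε (d a) = 0) ∧ ∀ a, ε.rTensor H (ρ a) = ε a ⊗ₜ[ℚ] (1 : H)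

namespace Cdga

variable {H : Type u} [CommRing H] [HopfAlgebra ℚ H]

instance : CoeSort (Cdga.{u, v} H) (Type v) := ⟨Cdga.carrier⟩

attribute [instance] Cdga.ring Cdga.algebra Cdga.graded

variable (A B : Cdga.{u, v} H)

theorem one_mem_deg : (1 : A) ∈ A.deg 0 := SetLike.GradedOne.one_mem

theorem d_one : A.d 1 = 0 := by
  have h := A.leibniz 0 1 A.one_mem_deg 1
  simpa using h

/-- The Adams degree `r` part of a cdga. -/
def adams (w : CentralCocharacter H) (r : ℤ) : Submodule ℚ A :=
  adamsPart w A.ρ.toLinearMap r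

/-- `A` is Adams connected: it is concentrated in Adams degrees `≥ 0`, and its part of Adams
degree `0` is `ℚ`. -/
def AdamsConnected (w : CentralCocharacter H) : Prop :=
  (∀ r < 0, A.adams w r = ⊥) ∧ A.adams w 0 = Submodule.span ℚ {1}

/-- `Z^n(A)` -/
def cocycles (n : ℤ) : Submodule ℚ A := A.deg n ⊓ LinearMap.ker A.d

/-- `B^n(A)` -/
def coboundaries (n : ℤ) : Submodule ℚ A := (A.deg (n - 1)).map A.d

/-- `H^n(A)` -/
abbrev Cohomology (n : ℤ) : Type v :=
  A.cocycles n ⧸ (A.coboundaries n).submoduleOf (A.cocycles n)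

/-- The map `ℚ → H^0(A)` given by the unit. -/
def unitCohomology : ℚ →ₗ[ℚ] A.Cohomology 0 :=
  LinearMap.toSpanSingleton ℚ _
    (Submodule.Quotient.mk ⟨1, A.one_mem_deg, LinearMap.mem_ker.2 A.d_one⟩)

/-- `A` is cohomologically connected: `H^n(A) = 0` for `n < 0` and `H^0(A) = ℚ`. -/
def CohomologicallyConnected : Prop :=
  (∀ n < 0, Subsingleton (A.Cohomology n)) ∧ Function.Bijective A.unitCohomology

variable {A B} in
/-- A map of cdgas over `G`. -/
structure Hom (A B : Cdga.{u, v} H) where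
  toAlgHom : A →ₐ[ℚ] B
  map_deg : ∀ n, ∀ a ∈ A.deg n, toAlgHom a ∈ B.deg n
  map_d : ∀ a, toAlgHom (A.d a) = B.d (toAlgHom a)
  equivariant : B.ρ.toLinearMap ∘ₗ toAlgHom.toLinearMap =
    toAlgHom.toLinearMap.rTensor H ∘ₗ A.ρ.toLinearMap

variable {A B}

theorem Hom.map_cocycles (f : Hom A B) (n : ℤ) :
    ∀ a ∈ A.cocycles n, f.toAlgHom.toLinearMap a ∈ B.cocycles n := by
  rintro a ⟨h₁, h₂⟩
  refine ⟨f.map_deg n a h₁, ?_⟩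
  have h₃ : A.d a = 0 := h₂
  change B.d (f.toAlgHom a) = 0
  rw [← f.map_d, h₃, map_zero]

theorem Hom.map_coboundaries (f : Hom A B) (n : ℤ) :
    (A.coboundaries n).submoduleOf (A.cocycles n) ≤
      ((B.coboundaries n).submoduleOf (B.cocycles n)).comap
        (f.toAlgHom.toLinearMap.restrict (f.map_cocycles n)) := by
  rintro ⟨a, ha⟩ ⟨b, hb, hab⟩
  refine ⟨f.toAlgHom b, f.map_deg _ b hb, ?_⟩
  have h : A.d b = a := hab
  change B.d (f.toAlgHom b) = f.toAlgHom a
  rw [← f.map_d, h]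

/-- The map induced on `H^n`. -/
def Hom.mapCohomology (f : Hom A B) (n : ℤ) : A.Cohomology n →ₗ[ℚ] B.Cohomology n :=
  Submodule.mapQ _ _ (f.toAlgHom.toLinearMap.restrict (f.map_cocycles n)) (f.map_coboundaries n)

end Cdga

/-! ### Free graded commutative algebras -/

section GradedSym

variable (E : ℤ → Type v) [∀ n, AddCommGroup (E n)] [∀ n, Module ℚ (E n)]

/-- A homogeneous element of `E` of degree `n` as a generator of the tensor algebra. -/
def gen (n : ℤ) (x : E n) : TensorAlgebra ℚ (⨁ n, E n) :=
  TensorAlgebra.ι ℚ (DirectSum.lof ℚ ℤ E n x)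

/-- The relations `x y = (-1) ^ (m n) y x` for `x` of degree `m` and `y` of degree `n`. -/
inductive GradedSymRel :
    TensorAlgebra ℚ (⨁ n, E n) → TensorAlgebra ℚ (⨁ n, E n) → Prop
  | comm (m n : ℤ) (x : E m) (y : E n) :
      GradedSymRel (gen E m x * gen E n y) ((m * n).negOnePow • (gen E n y * gen E m x))

/-- `Sym^* E`, the free graded commutative algebra on the graded vector space `E`. -/
abbrev GradedSym : Type v := RingQuot (GradedSymRel E)

end GradedSym

namespace Cdga

variable {H : Type u} [CommRing H] [HopfAlgebra ℚ H] (A : Cdga.{u, v} H)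

/-- The map `Sym^* E → A` given by the inclusion of a graded subspace `E ⊆ A`. -/
def symToAlg (E : ℤ → Submodule ℚ A) (hE : ∀ n, E n ≤ A.deg n) :
    GradedSym (fun n => E n) →ₐ[ℚ] A :=
  RingQuot.liftAlgHom ℚ
    ⟨TensorAlgebra.lift ℚ (DirectSum.toModule ℚ ℤ A (fun n => (E n).subtype)), by
      rintro _ _ ⟨m, n, x, y⟩
      have h := A.graded_comm m n x (hE m x.2) y (hE n y.2)
      rw [Units.smul_def] at h ⊢
      simpa [gen] using h⟩

/-- `A` is a free graded commutative algebra over `G`: `A = Sym^* E` for a graded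
representation `E` of `G` concentrated in positive degrees. -/
def IsFree : Prop :=
  ∃ (E : ℤ → Submodule ℚ A) (hE : ∀ n, E n ≤ A.deg n),
    (∀ n, IsSubrep A.ρ.toLinearMap (E n)) ∧ (∀ n ≤ 0, E n = ⊥) ∧
    Function.Bijective (A.symToAlg E hE)

/-- `A⟨n⟩`, the subalgebra generated by the elements of degree `≤ n`. -/
def sub (n : ℤ) : Subalgebra ℚ A := Algebra.adjoin ℚ {a | ∃ m ≤ n, a ∈ A.deg m}

/-- `A⟨n + 1, q⟩`, by recursion on `q`. -/
def subSucc (n : ℕ) : ℕ → Subalgebra ℚ A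
  | 0 => A.sub n
  | q + 1 => Algebra.adjoin ℚ
      ((A.sub n : Set A) ∪
        {x | x ∈ A.sub (n + 1) ∧ x ∈ A.deg (n + 1) ∧ A.d x ∈ subSucc n q})

/-- `A` is generalized nilpotent. -/
def GeneralizedNilpotent : Prop :=
  A.IsFree ∧ ∀ n : ℕ, (A.sub (n + 1) : Set A) = ⋃ q : ℕ, (A.subSucc n q : Set A)

variable {A}

/-- `s : M → A` is an `n`-minimal model of `A`, for a positive integer `n`. -/
structure IsMinimalModel (n : ℕ) {M : Cdga.{u, v} H} (s : Hom M A) : Prop where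
  generalizedNilpotent : M.GeneralizedNilpotent
  generated : M.sub n = ⊤
  bijective : ∀ m : ℤ, 1 ≤ m → m ≤ n → Function.Bijective (s.mapCohomology m)
  injective : Function.Injective (s.mapCohomology (n + 1))

/-- `s : M → A` is an `∞`-minimal model of `A`. -/
structure IsInftyMinimalModel {M : Cdga.{u, v} H} (s : Hom M A) : Prop where
  generalizedNilpotent : M.GeneralizedNilpotent
  quasiIso : ∀ m : ℤ, Function.Bijective (s.mapCohomology m)

end Cdga

end CdgaOver

end

universe w

noncomputable section

namespace CdgaOver

/-! The models are free cdgas over `A`, built by adjoining generators. For a free cdga s : X → A and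
n ≥ 1, consider the pairs (z, a) with z a cocycle of degree n + 1 in X, a of degree n in A and da =
s(z). Modulo boundaries they form H^n of the mapping cone of s, an extension of ker(H^{n+1}X →
H^{n+1}A) by coker(H^nX → H^nA). Reductivity, extended to infinite-dimensional representations by
local finiteness (`IsReductive.exists_complement`), provides a G-stable complement V of the
boundaries. Adjoin V in degree n with dv = z and s(v) = a. This makes s surjective on H^n and kills
the old kernel on H^{n+1} (`exists_pair`), while injectivity on H^n survives because V meets the
boundaries only in 0 (`injH_ext`). As generators have positive degree, nothing changes below degree
n, and degree n becomes X^n + V (`mem_deg_ext`).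

The new products can create new kernel on H^{n+1}, so the step (`Pre.step`) is iterated countably
often. In the colimit every element lives at a finite stage, and a kernel class of one stage dies in
the next (`Good.step`). Starting from ℚ and raising n gives nested n-minimal models, whose colimit
is the ∞-minimal model. Generalized nilpotence holds because the differential of a new generator
lies in the previous algebra (`nilpotent_ext`). If A is Adams connected, a new generator consists of
elements of nonzero cohomological degree, hence has only positive Adams degrees.

Every structure on Sym^*E is determined on generators. Algebra maps come from the universal
property, the differential is the corner entry of an algebra map to triangular matrices, and
identities between differentials follow from `linearMap_ext_of_leibniz`. -/

/-- The Koszul sign `(-1) ^ (m n)`, as a rational number. -/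
def koszul (m n : ℤ) : ℚ := ((m * n).negOnePow : ℤ)

/-- Signs are handled as rational scalars, so that they move through ℚ-linear maps and products like
any other scalar. -/
theorem negOnePow_smul_eq {V : Type*} [AddCommGroup V] [Module ℚ V] (n : ℤ) (x : V) :
    n.negOnePow • x = (((n.negOnePow : ℤˣ) : ℤ) : ℚ) • x := by
  rw [Units.smul_def, Int.cast_smul_eq_zsmul]

theorem koszul_smul {V : Type*} [AddCommGroup V] [Module ℚ V] (m n : ℤ) (x : V) :
    koszul m n • x = (m * n).negOnePow • x := (negOnePow_smul_eq _ _).symm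

/-! ### Free graded commutative algebras: universal property and functoriality -/

namespace GradedSym

variable {E : ℤ → Type v} [∀ n, AddCommGroup (E n)] [∀ n, Module ℚ (E n)]
variable {F : ℤ → Type v} [∀ n, AddCommGroup (F n)] [∀ n, Module ℚ (F n)]

/-- The inclusion of the generators of degree `n`. -/
def of (n : ℤ) : E n →ₗ[ℚ] GradedSym E :=
  (RingQuot.mkAlgHom ℚ (GradedSymRel E)).toLinearMap ∘ₗ TensorAlgebra.ι ℚ ∘ₗ
    DirectSum.lof ℚ ℤ E n

theorem of_eq_mk (n : ℤ) (x : E n) : of n x = RingQuot.mkAlgHom ℚ (GradedSymRel E) (gen E n x) :=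
  rfl

theorem of_mul_of (m n : ℤ) (x : E m) (y : E n) :
    of m x * of n y = koszul m n • (of n y * of m x) := by
  have h := RingQuot.mkAlgHom_rel ℚ (GradedSymRel.comm m n x y)
  rw [← koszul_smul, map_smul, map_mul, map_mul] at h
  exact h

section lift

variable {B : Type w} [Semiring B] [Algebra ℚ B]

/-- The universal property of `Sym^* E`. -/
def lift (f : ∀ n, E n →ₗ[ℚ] B)
    (hf : ∀ m n x y, f m x * f n y = koszul m n • (f n y * f m x)) :
    GradedSym E →ₐ[ℚ] B :=
  RingQuot.liftAlgHom ℚ ⟨TensorAlgebra.lift ℚ (DirectSum.toModule ℚ ℤ B f), by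
    rintro _ _ ⟨m, n, x, y⟩
    rw [← koszul_smul]
    simpa [gen] using hf m n x y⟩

@[simp]
theorem lift_of (f : ∀ n, E n →ₗ[ℚ] B)
    (hf : ∀ m n x y, f m x * f n y = koszul m n • (f n y * f m x)) (n : ℤ) (x : E n) :
    lift f hf (of n x) = f n x := by
  rw [of_eq_mk, lift, RingQuot.liftAlgHom_mkAlgHom_apply]
  simp [gen]

theorem hom_ext {f g : GradedSym E →ₐ[ℚ] B} (h : ∀ n x, f (of n x) = g (of n x)) : f = g := by
  apply RingQuot.ringQuot_ext'
  apply TensorAlgebra.hom_ext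
  apply DirectSum.linearMap_ext
  intro n
  ext x
  exact h n x

end lift

/-- The universal property maps `GradedSym E` into the subalgebra `S`; followed by the inclusion
this fixes the generators, so it is the identity. -/
theorem adjoin_of : Algebra.adjoin ℚ {a : GradedSym E | ∃ n x, of n x = a} = ⊤ := by
  set S := Algebra.adjoin ℚ {a : GradedSym E | ∃ n x, of n x = a}
  let f : GradedSym E →ₐ[ℚ] S := lift (E := E) (B := S)
    (fun n => (of n).codRestrict (Subalgebra.toSubmodule S)
      fun x => Algebra.subset_adjoin (s := {a | ∃ n x, of n x = a}) ⟨n, x, rfl⟩)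
    (fun m n x y => by
      apply Subtype.ext
      exact of_mul_of m n x y)
  have h : S.val.comp f = AlgHom.id ℚ _ := by
    apply hom_ext
    intro n x
    simp only [AlgHom.comp_apply, AlgHom.id_apply, f, lift_of]
    rfl
  rw [eq_top_iff]
  intro x _
  have := DFunLike.congr_fun h x
  rw [AlgHom.comp_apply, AlgHom.id_apply] at this
  rw [← this]
  exact (f x).2

@[elab_as_elim]
theorem induction {p : GradedSym E → Prop} (algebraMap : ∀ r, p (algebraMap ℚ _ r))
    (of : ∀ n x, p (of n x)) (add : ∀ a b, p a → p b → p (a + b))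
    (mul : ∀ a b, p a → p b → p (a * b)) (a : GradedSym E) : p a := by
  have ha : a ∈ Algebra.adjoin ℚ {a : GradedSym E | ∃ n x, GradedSym.of n x = a} := by
    rw [adjoin_of]; trivial
  induction ha using Algebra.adjoin_induction with
  | mem x hx => obtain ⟨n, y, rfl⟩ := hx; exact of n y
  | algebraMap r => exact algebraMap r
  | add x y _ _ hx hy => exact add x y hx hy
  | mul x y _ _ hx hy => exact mul x y hx hy

/-- Functoriality of `Sym^*`. -/
def map (f : ∀ n, E n →ₗ[ℚ] F n) : GradedSym E →ₐ[ℚ] GradedSym F :=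
  lift (E := E) (fun n => of n ∘ₗ f n) fun m n x y => of_mul_of m n (f m x) (f n y)

@[simp]
theorem map_of (f : ∀ n, E n →ₗ[ℚ] F n) (n : ℤ) (x : E n) : map f (of n x) = of n (f n x) :=
  lift_of _ _ n x

/-- Over a field each `f n` has a linear retraction, and functoriality turns these into a retraction
of `map f`. -/
theorem map_injective {f : ∀ n, E n →ₗ[ℚ] F n} (hf : ∀ n, Function.Injective (f n)) :
    Function.Injective (map f) := by
  choose g hg using fun n => LinearMap.exists_leftInverse_of_injective (f n)
    (LinearMap.ker_eq_bot.2 (hf n))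
  have h : (map g).comp (map f) = AlgHom.id ℚ _ := by
    apply hom_ext
    intro n x
    simpa using congrArg (of n) (LinearMap.congr_fun (hg n) x)
  intro a b hab
  have h' := fun c => DFunLike.congr_fun h c
  simp only [AlgHom.comp_apply, AlgHom.id_apply] at h'
  rw [← h' a, hab, h']

/-! ### The grading -/

/-- The coaction of `𝔾ₘ` on `Sym^* E` defining the grading. -/
def gradingHom : GradedSym E →ₐ[ℚ] AddMonoidAlgebra (GradedSym E) ℤ :=
  lift (E := E) (B := AddMonoidAlgebra (GradedSym E) ℤ) (fun n => (AddMonoidAlgebra.lsingle (R := ℚ) n) ∘ₗ of n) fun m n x y => by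
    change AddMonoidAlgebra.single m (of m x) * AddMonoidAlgebra.single n (of n y) =
      koszul m n • (AddMonoidAlgebra.single n (of n y) * AddMonoidAlgebra.single m (of m x))
    rw [AddMonoidAlgebra.single_mul_single, AddMonoidAlgebra.single_mul_single, of_mul_of,
      AddMonoidAlgebra.smul_single, add_comm]

@[simp]
theorem gradingHom_of (n : ℤ) (x : E n) :
    gradingHom (of n x) = AddMonoidAlgebra.single n (of n x) := lift_of _ _ n x

variable (E) in
/-- The elements of degree `n`. -/
def deg (n : ℤ) : Submodule ℚ (GradedSym E) :=
  -- Being homogeneous is an equation between an algebra map and a monomial embedding, which makes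
  -- closure under products immediate.
  LinearMap.eqLocus (gradingHom (E := E)).toLinearMap (AddMonoidAlgebra.lsingle (R := ℚ) n)

theorem mem_deg {n : ℤ} {a : GradedSym E} :
    a ∈ deg E n ↔ gradingHom a = AddMonoidAlgebra.single n a := Iff.rfl

theorem of_mem_deg (n : ℤ) (x : E n) : of n x ∈ deg E n := gradingHom_of n x

instance : SetLike.GradedMonoid (deg E) where
  one_mem := by rw [mem_deg, map_one]; rfl
  mul_mem i j a b ha hb := by
    rw [mem_deg] at *
    rw [map_mul, ha, hb, AddMonoidAlgebra.single_mul_single]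

section Decomposition

variable (N : ℤ → Submodule ℚ (GradedSym E))

variable {N} in
theorem directSum_of_congr {m n : ℤ} (h : m = n) {a : GradedSym E} (ha : a ∈ N m) :
    DirectSum.of (fun i => N i) m ⟨a, ha⟩ = DirectSum.of (fun i => N i) n ⟨a, h ▸ ha⟩ := by
  subst h; rfl

variable [SetLike.GradedMonoid N]

variable {N} in
/-- The decomposition into components in a multiplicative family of subspaces containing the
generators. -/
def decomposeHom (hN : ∀ n x, of n x ∈ N n) : GradedSym E →ₐ[ℚ] ⨁ i, N i :=
  lift (E := E) (B := ⨁ i, N i) (fun n => DirectSum.lof ℚ ℤ (fun i => N i) n ∘ₗ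
      (of n).codRestrict (N n) (hN n)) fun m n x y => by
    change DirectSum.of (fun i => N i) m _ * DirectSum.of (fun i => N i) n _ =
      koszul m n • (DirectSum.of (fun i => N i) n _ * DirectSum.of (fun i => N i) m _)
    rw [DirectSum.of_mul_of, DirectSum.of_mul_of, ← DirectSum.lof_eq_of ℚ,
      ← DirectSum.lof_eq_of ℚ, ← map_smul]
    refine (directSum_of_congr (add_comm m n)
      (SetLike.mul_mem_graded (hN m x) (hN n y))).trans ?_
    exact congrArg (DirectSum.lof ℚ ℤ (fun i => N i) (n + m))
      (Subtype.ext (of_mul_of m n x y))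

theorem decomposeHom_of (hN : ∀ n x, of n x ∈ N n) (n : ℤ) (x : E n) :
    decomposeHom hN (of n x) = DirectSum.of (fun i => N i) n ⟨of n x, hN n x⟩ :=
  lift_of _ _ n x

/-- A family of homogeneous components as a Laurent polynomial. -/
def toLaurent : (⨁ i, N i) →ₐ[ℚ] AddMonoidAlgebra (GradedSym E) ℤ :=
  DirectSum.toAlgebra ℚ _ (fun i => AddMonoidAlgebra.lsingle (R := ℚ) i ∘ₗ (N i).subtype) rfl
    fun {i j} a b => by
      change AddMonoidAlgebra.single (i + j) (a.1 * b.1) =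
        AddMonoidAlgebra.single i a.1 * AddMonoidAlgebra.single j b.1
      rw [AddMonoidAlgebra.single_mul_single]

@[simp]
theorem toLaurent_of (n : ℤ) (a : N n) :
    toLaurent N (DirectSum.of (fun i => N i) n a) = AddMonoidAlgebra.single n (a : GradedSym E) :=
  DirectSum.toAddMonoid_of _ _ _

theorem coeff_toLaurent (y : ⨁ i, N i) (n : ℤ) : (toLaurent N y).coeff n = y n := by
  induction y using DirectSum.induction_on with
  | zero => simp
  | of m a =>
    rw [toLaurent_of, AddMonoidAlgebra.coeff_single, Finsupp.single_apply, DirectSum.coe_of_apply]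
    split_ifs <;> rfl
  | add a b ha hb => simp [ha, hb]

theorem toLaurent_decomposeHom (hN : ∀ n x, of n x ∈ N n) (a : GradedSym E) :
    toLaurent N (decomposeHom hN a) = gradingHom a := by
  rw [← AlgHom.comp_apply]
  congr 1
  apply hom_ext
  intro n x
  rw [AlgHom.comp_apply, decomposeHom_of, toLaurent_of, gradingHom_of]

/-- A multiplicative family of subspaces containing the generators contains all homogeneous
elements. -/
theorem deg_le (hN : ∀ n x, of n x ∈ N n) (n : ℤ) : deg E n ≤ N n := by
  intro a ha
  rw [mem_deg] at ha
  -- The decomposition of `a` along `N` has Laurent polynomial `gradingHom a`, the single monomial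
  -- a·T^n; its coefficient at n exhibits `a` as an element of `N n`.
  have h := coeff_toLaurent N (decomposeHom hN a) n
  rw [toLaurent_decomposeHom, ha] at h
  simp only [AddMonoidAlgebra.coeff_single, Finsupp.single_eq_same] at h
  rw [h]
  exact (decomposeHom hN a n).2

end Decomposition

instance : GradedAlgebra (deg E) :=
  GradedAlgebra.ofAlgHom (deg E) (decomposeHom of_mem_deg)
    (by
      apply hom_ext
      intro n x
      rw [AlgHom.comp_apply, decomposeHom_of, DirectSum.coeAlgHom_of, AlgHom.id_apply])
    -- A family of components is determined by its Laurent polynomial.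
    (by
      intro n a
      apply DFinsupp.ext
      intro i
      apply Subtype.ext
      rw [← coeff_toLaurent, ← coeff_toLaurent, toLaurent_decomposeHom, toLaurent_of,
        mem_deg.1 a.2])

@[elab_as_elim]
theorem homogeneous_induction {p : GradedSym E → Prop} (zero : p 0)
    (homogeneous : ∀ n, ∀ a ∈ deg E n, p a) (add : ∀ a b, p a → p b → p (a + b))
    (a : GradedSym E) : p a :=
  DirectSum.Decomposition.inductionOn (deg E) zero (fun {n} a => homogeneous n a a.2) add a

/-! ### Signs -/

/-- The pattern used for all statements on homogeneous elements: the property defines a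
multiplicative family `N` of subspaces, and `deg_le` reduces it to the generators. -/
theorem map_mem_deg (f : ∀ n, E n →ₗ[ℚ] F n) {n : ℤ} {a : GradedSym E} (ha : a ∈ deg E n) :
    map f a ∈ deg F n := by
  let N : ℤ → Submodule ℚ (GradedSym E) := fun n => (deg F n).comap (map f).toLinearMap
  have : SetLike.GradedMonoid N :=
    { one_mem := by simpa [N] using SetLike.GradedOne.one_mem
      mul_mem := fun i j a b ha hb => by
        simpa [N] using SetLike.mul_mem_graded (A := deg F) ha hb }
  refine deg_le N (fun n x => ?_) n ha
  simpa [N] using of_mem_deg n (f n x)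

end GradedSym

theorem koszul_comm (m n : ℤ) : koszul m n = koszul n m := by rw [koszul, koszul, mul_comm]

theorem koszul_add (m i j : ℤ) : koszul m (i + j) = koszul m i * koszul m j := by
  simp only [koszul, mul_add, Int.negOnePow_add, Units.val_mul, Int.cast_mul]

theorem koszul_add_left (i j m : ℤ) : koszul (i + j) m = koszul i m * koszul j m := by
  rw [koszul_comm, koszul_add, koszul_comm m, koszul_comm m]

@[simp] theorem koszul_zero (m : ℤ) : koszul m 0 = 1 := by simp [koszul]

@[simp] theorem koszul_mul_self (m n : ℤ) : koszul m n * koszul m n = 1 := by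
  rw [koszul, ← Int.cast_mul, ← Units.val_mul, ← Int.negOnePow_add, Int.negOnePow_even _ ⟨_, rfl⟩]
  rfl

namespace GradedSym

variable {E : ℤ → Type v} [∀ n, AddCommGroup (E n)] [∀ n, Module ℚ (E n)]
variable {F : ℤ → Type v} [∀ n, AddCommGroup (F n)] [∀ n, Module ℚ (F n)]

variable (E) in
/-- The automorphism multiplying elements of degree `n` by `(-1) ^ (m n)`. -/
def twist (m : ℤ) : GradedSym E →ₐ[ℚ] GradedSym E :=
  lift (fun n => koszul m n • of n) fun i j x y => by
    simp only [LinearMap.smul_apply, smul_mul_smul_comm]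
    rw [of_mul_of, smul_comm, mul_comm]

@[simp]
theorem twist_of (m n : ℤ) (x : E n) : twist E m (of n x) = koszul m n • of n x :=
  lift_of _ _ n x

theorem twist_of_mem (m : ℤ) {n : ℤ} {a : GradedSym E} (ha : a ∈ deg E n) :
    twist E m a = koszul m n • a := by
  let N : ℤ → Submodule ℚ (GradedSym E) := fun n =>
    LinearMap.eqLocus (twist E m).toLinearMap (koszul m n • LinearMap.id)
  have hN : ∀ {n a}, a ∈ N n ↔ twist E m a = koszul m n • a := Iff.rfl
  have : SetLike.GradedMonoid N :=
    { one_mem := by rw [hN]; simp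
      mul_mem := fun i j a b ha hb => by
        rw [hN] at *
        rw [map_mul, ha, hb, smul_mul_smul_comm, koszul_add] }
  exact deg_le N (fun n x => twist_of m n x) n ha

/-- The relations give commutation of generators only. It is extended one factor at a time, here on
the left and in `mul_eq_twist_mul` on the right; `twist` carries the sign, so the factor being
twisted need not be homogeneous. -/
theorem mul_of (a : GradedSym E) (n : ℤ) (x : E n) : a * of n x = of n x * twist E n a := by
  induction a using induction with
  | algebraMap r => rw [AlgHom.commutes, Algebra.commutes]
  | of m y => rw [twist_of, of_mul_of, koszul_comm, mul_smul_comm]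
  | add a b ha hb => rw [add_mul, ha, hb, map_add, mul_add]
  | mul a b ha hb => rw [mul_assoc, hb, ← mul_assoc, ha, map_mul, mul_assoc]

theorem mul_eq_twist_mul {m : ℤ} {a : GradedSym E} (ha : a ∈ deg E m) (b : GradedSym E) :
    a * b = twist E m b * a := by
  induction b using induction with
  | algebraMap r => rw [AlgHom.commutes, Algebra.commutes]
  | of n y => rw [twist_of, mul_of, twist_of_mem n ha, koszul_comm, mul_smul_comm, smul_mul_assoc]
  | add b c hb hc => rw [mul_add, hb, hc, map_add, add_mul]
  | mul b c hb hc => rw [← mul_assoc, hb, mul_assoc, hc, map_mul, mul_assoc]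

theorem graded_comm {m n : ℤ} {a b : GradedSym E} (ha : a ∈ deg E m) (hb : b ∈ deg E n) :
    a * b = koszul m n • (b * a) := by
  rw [mul_eq_twist_mul ha, twist_of_mem m hb, smul_mul_assoc]

theorem twist_twist (m : ℤ) (a : GradedSym E) : twist E m (twist E m a) = a := by
  rw [← AlgHom.comp_apply]
  conv_rhs => rw [← AlgHom.id_apply (R := ℚ) a]
  congr 1
  apply hom_ext
  intro n x
  simp [smul_smul]

/-! ### Derivations -/

/-- A derivation along two algebra maps is determined on generators. General `φ`, `ψ` are allowed so
that composites of a differential with a coaction, an augmentation or a map of cdgas are covered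
too. -/
theorem linearMap_ext_of_leibniz {B : Type w} [Ring B] [Algebra ℚ B] (φ ψ : GradedSym E →ₐ[ℚ] B)
    (D₁ D₂ : GradedSym E →ₗ[ℚ] B) (h₁ : ∀ a b, D₁ (a * b) = D₁ a * φ b + ψ a * D₁ b)
    (h₂ : ∀ a b, D₂ (a * b) = D₂ a * φ b + ψ a * D₂ b) (h : ∀ n x, D₁ (of n x) = D₂ (of n x)) :
    D₁ = D₂ := by
  have h1 : D₁ 1 = 0 := by simpa using h₁ 1 1
  have h2 : D₂ 1 = 0 := by simpa using h₂ 1 1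
  ext a
  induction a using induction with
  | algebraMap r => rw [Algebra.algebraMap_eq_smul_one, map_smul, map_smul, h1, h2]
  | of n x => exact h n x
  | add a b ha hb => rw [map_add, map_add, ha, hb]
  | mul a b ha hb => rw [h₁, h₂, ha, hb]

section der

variable (D : ∀ n, E n →ₗ[ℚ] GradedSym E) (hD : ∀ n x, D n x ∈ deg E (n + 1))

/-- The algebra map `a ↦ ((±a, da), (0, a))` encoding the derivation with given values on the
generators. -/
def derMatrix : GradedSym E →ₐ[ℚ] Matrix (Fin 2) (Fin 2) (GradedSym E) :=
  lift (E := E) (B := Matrix (Fin 2) (Fin 2) (GradedSym E))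
    (fun n =>
      { toFun x := !![koszul 1 n • of n x, D n x; 0, of n x]
        map_add' x y := by ext i j; fin_cases i <;> fin_cases j <;> simp
        map_smul' r x := by
          ext i j; fin_cases i <;> fin_cases j <;> simp [smul_comm r] })
    fun m n x y => by
      have h₁ := graded_comm (of_mem_deg m x) (hD n y)
      have h₂ := graded_comm (hD m x) (of_mem_deg n y)
      have h₃ := of_mul_of m n x y
      rw [koszul_add, ← koszul_comm 1] at h₁
      rw [koszul_add_left] at h₂
      -- The twist contributes (-1)^m, which cancels the extra (-1)^m due to `D n y` having degree n
      -- + 1; `e₂` is symmetric. The two terms of the corner entry are thereby exchanged.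
      have e₁ : koszul 1 m • of m x * D n y = koszul m n • (D n y * of m x) := by
        rw [smul_mul_assoc, h₁, smul_smul, mul_left_comm, koszul_mul_self, mul_one]
      have e₂ : D m x * of n y = koszul m n • (koszul 1 n • of n y * D m x) := by
        rw [h₂, smul_mul_assoc, smul_smul]
      have e₃ : (koszul 1 m • of m x) * (koszul 1 n • of n y) =
          koszul m n • ((koszul 1 n • of n y) * (koszul 1 m • of m x)) := by
        rw [smul_mul_smul_comm, smul_mul_smul_comm, h₃, smul_comm, mul_comm (koszul 1 m)]
      change !![koszul 1 m • of m x, D m x; 0, of m x] * !![koszul 1 n • of n y, D n y; 0, of n y] =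
        koszul m n • (!![koszul 1 n • of n y, D n y; 0, of n y] *
          !![koszul 1 m • of m x, D m x; 0, of m x])
      rw [Matrix.mul_fin_two, Matrix.mul_fin_two, e₁, e₂, e₃, h₃]
      ext i j
      fin_cases i <;> fin_cases j
      · simp
      · simpa using add_comm _ _
      · simp
      · simp

/-- The derivation of degree `1` with given values on the generators. -/
def der : GradedSym E →ₗ[ℚ] GradedSym E where
  toFun a := derMatrix D hD a 0 1
  map_add' a b := by rw [map_add]; rfl
  map_smul' r a := by rw [map_smul]; rfl

theorem derMatrix_apply (a : GradedSym E) :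
    derMatrix D hD a 0 0 = twist E 1 a ∧ derMatrix D hD a 1 1 = a := by
  -- The zero in the lower left corner must be carried along, since it enters the diagonal entries
  -- of a product.
  suffices h : derMatrix D hD a 0 0 = twist E 1 a ∧ derMatrix D hD a 1 1 = a ∧
    derMatrix D hD a 1 0 = 0 from ⟨h.1, h.2.1⟩
  induction a using induction with
  | algebraMap r =>
    rw [AlgHom.commutes, AlgHom.commutes, Matrix.algebraMap_eq_diagonal]
    simp
  | of n x => rw [derMatrix, lift_of, twist_of]; simp
  | add a b ha hb => simp [ha, hb]
  | mul a b ha hb => simp [Matrix.mul_apply, ha, hb]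

@[simp]
theorem der_of (n : ℤ) (x : E n) : der D hD (of n x) = D n x := by
  change derMatrix D hD (of n x) 0 1 = D n x
  rw [derMatrix, lift_of]
  rfl

theorem der_mul (a b : GradedSym E) :
    der D hD (a * b) = der D hD a * b + twist E 1 a * der D hD b := by
  change derMatrix D hD (a * b) 0 1 = derMatrix D hD a 0 1 * b + _ * derMatrix D hD b 0 1
  rw [map_mul, Matrix.mul_apply, Fin.sum_univ_two, (derMatrix_apply D hD a).1,
    (derMatrix_apply D hD b).2, add_comm]

theorem der_mem {n : ℤ} {a : GradedSym E} (ha : a ∈ deg E n) : der D hD a ∈ deg E (n + 1) := by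
  -- Homogeneity of the element itself is kept in the family, because the Leibniz rule for a product
  -- needs it.
  let N : ℤ → Submodule ℚ (GradedSym E) := fun n => deg E n ⊓ (deg E (n + 1)).comap (der D hD)
  have h1 : der D hD 1 = 0 := by simpa using der_mul D hD 1 1
  have : SetLike.GradedMonoid N :=
    { one_mem := ⟨SetLike.GradedOne.one_mem, by simp [h1]⟩
      mul_mem := fun i j a b ha hb => by
        refine ⟨SetLike.mul_mem_graded ha.1 hb.1, ?_⟩
        change der D hD (a * b) ∈ deg E (i + j + 1)
        rw [der_mul, twist_of_mem 1 ha.1, smul_mul_assoc]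
        refine add_mem ?_ (Submodule.smul_mem _ _ ?_)
        · rw [add_right_comm]
          exact SetLike.mul_mem_graded ha.2 hb.1
        · rw [add_assoc]
          exact SetLike.mul_mem_graded ha.1 hb.2 }
  exact (deg_le N (fun n x => ⟨of_mem_deg n x, by simpa using hD n x⟩) n ha).2

theorem twist_der (a : GradedSym E) : twist E 1 (der D hD a) = (-1 : ℚ) • der D hD (twist E 1 a) := by
  induction a using homogeneous_induction with
  | zero => simp
  | homogeneous n a ha =>
    rw [twist_of_mem 1 (der_mem D hD ha), twist_of_mem 1 ha, map_smul, koszul_add,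
      show koszul 1 1 = -1 by simp [koszul], mul_comm, mul_smul]
  | add a b ha hb => rw [map_add, map_add, ha, hb, map_add, map_add, smul_add]

/-- The square of an odd derivation is an honest derivation: the cross terms cancel by `twist_der`.
So it vanishes once it vanishes on generators. -/
theorem der_der (h : ∀ n x, der D hD (D n x) = 0) (a : GradedSym E) :
    der D hD (der D hD a) = 0 := by
  refine LinearMap.congr_fun (linearMap_ext_of_leibniz (AlgHom.id ℚ _) (AlgHom.id ℚ _)
    (der D hD ∘ₗ der D hD) 0 ?_ ?_ ?_) a
  · intro a b
    simp only [LinearMap.comp_apply, der_mul, map_add, AlgHom.id_apply, twist_der, twist_twist]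
    rw [smul_mul_assoc, add_assoc, ← add_assoc ((-1 : ℚ) • _)]
    nth_rw 2 [← one_smul ℚ (der D hD ((twist E 1) a) * _)]
    rw [← add_smul, neg_add_cancel, zero_smul, zero_add]
  · simp
  · simpa using h

end der

end GradedSym

end CdgaOver

namespace CdgaOver

/-! ### Representations -/

section Slice

variable {C : Type*} [AddCommGroup C] [Module ℚ C]
variable {V : Type*} [AddCommGroup V] [Module ℚ V] {V' : Type*} [AddCommGroup V'] [Module ℚ V']

variable (V) in
/-- The contraction `V ⊗ C → V` with a linear form on `C`. -/
def slice (φ : C →ₗ[ℚ] ℚ) : V ⊗[ℚ] C →ₗ[ℚ] V :=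
  (TensorProduct.rid ℚ V).toLinearMap ∘ₗ φ.lTensor V

@[simp]
theorem slice_tmul (φ : C →ₗ[ℚ] ℚ) (x : V) (c : C) : slice V φ (x ⊗ₜ c) = φ c • x := by
  simp [slice]

theorem slice_rTensor (φ : C →ₗ[ℚ] ℚ) (f : V →ₗ[ℚ] V') (t : V ⊗[ℚ] C) :
    slice V' φ (f.rTensor C t) = f (slice V φ t) := by
  induction t with
  | zero => simp
  | tmul x c => simp
  | add s t hs ht => simp only [map_add, hs, ht]

theorem slice_lTensor {C' : Type*} [AddCommGroup C'] [Module ℚ C'] (g : C →ₗ[ℚ] C')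
    (φ : C' →ₗ[ℚ] ℚ) (t : V ⊗[ℚ] C) : slice V φ (g.lTensor V t) = slice V (φ ∘ₗ g) t := by
  rw [slice, slice, LinearMap.lTensor_comp]; rfl

theorem eq_zero_of_slice_coord {ι : Type*} (b : Module.Basis ι ℚ C) {t : V ⊗[ℚ] C}
    (h : ∀ i, slice V (b.coord i) t = 0) : t = 0 := by
  classical
  apply (TensorProduct.equivFinsuppOfBasisRight b).injective
  ext i
  rw [TensorProduct.equivFinsuppOfBasisRight_apply, map_zero]
  exact h i

/-- By right exactness W ⊗ C is the kernel of V ⊗ C → (V/W) ⊗ C, and a tensor over a field is zero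
when its coordinates along a basis of C are. -/
theorem mem_range_rTensor_subtype {W : Submodule ℚ V} {t : V ⊗[ℚ] C} :
    t ∈ LinearMap.range (W.subtype.rTensor C) ↔ ∀ φ, slice V φ t ∈ W := by
  constructor
  · rintro ⟨s, rfl⟩ φ
    rw [slice_rTensor]
    exact (slice W φ s).2
  · intro h
    have hex := rTensor_exact C (LinearMap.exact_subtype_mkQ W) W.mkQ_surjective
    rw [LinearMap.mem_range, ← Set.mem_range, ← hex t]
    apply eq_zero_of_slice_coord (Module.Basis.ofVectorSpace ℚ C)
    intro i
    rw [slice_rTensor]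
    simpa using h _

theorem exists_finiteDimensional_slice_mem (t : V ⊗[ℚ] C) :
    ∃ W : Submodule ℚ V, FiniteDimensional ℚ W ∧ ∀ φ, slice V φ t ∈ W := by
  induction t with
  | zero => exact ⟨⊥, inferInstance, by simp⟩
  | tmul x c =>
    refine ⟨ℚ ∙ x, inferInstance, fun φ => ?_⟩
    rw [slice_tmul]
    exact Submodule.smul_mem _ _ (Submodule.mem_span_singleton_self x)
  | add s t hs ht =>
    obtain ⟨W₁, _, h₁⟩ := hs
    obtain ⟨W₂, _, h₂⟩ := ht
    refine ⟨W₁ ⊔ W₂, inferInstance, fun φ => ?_⟩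
    rw [map_add]
    exact add_mem (Submodule.mem_sup_left (h₁ φ)) (Submodule.mem_sup_right (h₂ φ))

theorem rTensor_injective {f : V →ₗ[ℚ] V'} (hf : Function.Injective f) :
    Function.Injective (f.rTensor C) :=
  Module.Flat.rTensor_preserves_injective_linearMap f hf

end Slice

section Representations

variable {H : Type u} [CommRing H] [HopfAlgebra ℚ H]
variable {V : Type v} [AddCommGroup V] [Module ℚ V] {V' : Type w} [AddCommGroup V'] [Module ℚ V']
variable {ρ : V →ₗ[ℚ] V ⊗[ℚ] H} {ρ' : V' →ₗ[ℚ] V' ⊗[ℚ] H}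

/-- The action of a linear form on the coordinate ring on a representation. -/
def op (ρ : V →ₗ[ℚ] V ⊗[ℚ] H) (φ : H →ₗ[ℚ] ℚ) : V →ₗ[ℚ] V := slice V φ ∘ₗ ρ

/-- This replaces the comodule condition by stability under operators; nearly all later checks of
subrepresentations use it. -/
theorem isSubrep_iff {W : Submodule ℚ V} : IsSubrep ρ W ↔ ∀ φ, ∀ x ∈ W, op ρ φ x ∈ W := by
  simp only [IsSubrep, mem_range_rTensor_subtype]
  exact ⟨fun h φ x hx => h x hx φ, fun h x hx φ => h φ x hx⟩

theorem op_map {f : V →ₗ[ℚ] V'} (hf : ρ' ∘ₗ f = f.rTensor H ∘ₗ ρ) (φ : H →ₗ[ℚ] ℚ) (x : V) :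
    op ρ' φ (f x) = f (op ρ φ x) := by
  change slice V' φ ((ρ' ∘ₗ f) x) = _
  rw [hf]
  exact slice_rTensor φ f (ρ x)

/-- The product of linear forms on the coordinate ring. -/
def conv (φ ψ : H →ₗ[ℚ] ℚ) : H →ₗ[ℚ] ℚ :=
  (TensorProduct.lid ℚ ℚ).toLinearMap ∘ₗ TensorProduct.map φ ψ ∘ₗ Coalgebra.comul

/-- Coassociativity makes the operators closed under composition; this is what makes the orbit of a
vector stable. -/
theorem op_op (h : IsRep ρ) (φ ψ : H →ₗ[ℚ] ℚ) (x : V) :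
    op ρ φ (op ρ ψ x) = op ρ (conv φ ψ) x := by
  -- `ρ x` is replaced by an arbitrary tensor so that induction on tensors applies.
  have key (t : V ⊗[ℚ] H) : op ρ φ (slice V ψ t) =
      slice V ((TensorProduct.lid ℚ ℚ).toLinearMap ∘ₗ TensorProduct.map φ ψ)
        (TensorProduct.assoc ℚ V H H (ρ.rTensor H t)) := by
    induction t with
    | zero => simp
    | add s t hs ht => simp only [map_add, hs, ht]
    | tmul y c =>
      rw [slice_tmul, map_smul, LinearMap.rTensor_tmul]
      change ψ c • slice V φ (ρ y) = _
      generalize ρ y = s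
      induction s with
      | zero => simp
      | add s t hs ht => simp only [map_add, smul_add, hs, ht, TensorProduct.add_tmul]
      | tmul z e => simp [smul_smul, mul_comm]
  have h1 := LinearMap.congr_fun h.coassoc x
  change op ρ φ (slice V ψ (ρ x)) = slice V (conv φ ψ) (ρ x)
  rw [key]
  have h2 : TensorProduct.assoc ℚ V H H (ρ.rTensor H (ρ x)) =
    (Coalgebra.comul (R := ℚ) (A := H)).lTensor V (ρ x) := h1
  rw [h2, slice_lTensor]
  rfl

theorem op_counit (h : IsRep ρ) (x : V) : op ρ Coalgebra.counit x = x :=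
  LinearMap.congr_fun h.counit x

/-! #### Transport of the axioms along equivariant maps -/

theorem assoc_rTensor_rTensor (f : V →ₗ[ℚ] V') (t : (V ⊗[ℚ] H) ⊗[ℚ] H) :
    TensorProduct.assoc ℚ V' H H ((f.rTensor H).rTensor H t) =
      f.rTensor (H ⊗[ℚ] H) (TensorProduct.assoc ℚ V H H t) := by
  refine LinearMap.congr_fun (f := (TensorProduct.assoc ℚ V' H H).toLinearMap ∘ₗ
    (f.rTensor H).rTensor H) (g := f.rTensor (H ⊗[ℚ] H) ∘ₗ
    (TensorProduct.assoc ℚ V H H).toLinearMap) ?_ t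
  ext
  simp

theorem coassoc_map {f : V →ₗ[ℚ] V'} (hf : ρ' ∘ₗ f = f.rTensor H ∘ₗ ρ) :
    ((TensorProduct.assoc ℚ V' H H).toLinearMap ∘ₗ ρ'.rTensor H ∘ₗ ρ') ∘ₗ f =
      f.rTensor (H ⊗[ℚ] H) ∘ₗ
        ((TensorProduct.assoc ℚ V H H).toLinearMap ∘ₗ ρ.rTensor H ∘ₗ ρ) := by
  ext x
  simp only [LinearMap.comp_apply, LinearEquiv.coe_coe]
  rw [← LinearMap.comp_apply ρ' f, hf, LinearMap.comp_apply, ← LinearMap.rTensor_comp_apply, hf,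
    LinearMap.rTensor_comp_apply, assoc_rTensor_rTensor]

theorem lTensor_comul_map {f : V →ₗ[ℚ] V'} (hf : ρ' ∘ₗ f = f.rTensor H ∘ₗ ρ) :
    ((Coalgebra.comul (R := ℚ) (A := H)).lTensor V' ∘ₗ ρ') ∘ₗ f =
      f.rTensor (H ⊗[ℚ] H) ∘ₗ ((Coalgebra.comul (R := ℚ) (A := H)).lTensor V ∘ₗ ρ) := by
  rw [LinearMap.comp_assoc, hf, ← LinearMap.comp_assoc, ← LinearMap.comp_assoc,
    LinearMap.lTensor_comp_rTensor, LinearMap.rTensor_comp_lTensor]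

theorem IsRep.coassoc_comp (h : IsRep ρ) (f : V →ₗ[ℚ] V') (hf : ρ' ∘ₗ f = f.rTensor H ∘ₗ ρ) :
    ((TensorProduct.assoc ℚ V' H H).toLinearMap ∘ₗ ρ'.rTensor H ∘ₗ ρ') ∘ₗ f =
      ((Coalgebra.comul (R := ℚ) (A := H)).lTensor V' ∘ₗ ρ') ∘ₗ f := by
  rw [coassoc_map hf, lTensor_comul_map hf, h.coassoc]

/-- Both axioms can be tested after `f`, as tensoring over a field preserves its injectivity. -/
theorem IsRep.of_injective (h : IsRep ρ') {f : V →ₗ[ℚ] V'} (hf : ρ' ∘ₗ f = f.rTensor H ∘ₗ ρ)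
    (hi : Function.Injective f) : IsRep ρ where
  coassoc := by
    rw [← LinearMap.cancel_left (rTensor_injective (C := H ⊗[ℚ] H) hi), ← coassoc_map hf,
      ← lTensor_comul_map hf, h.coassoc]
  counit := by
    ext x
    apply hi
    change f (op ρ Coalgebra.counit x) = f x
    rw [← op_map hf, op_counit h]

/-- A coaction is a representation if the space is covered by images of representations. -/
theorem IsRep.of_forall (h : ∀ y : V', ∃ (V : Type v) (_ : AddCommGroup V) (_ : Module ℚ V)
    (ρ : V →ₗ[ℚ] V ⊗[ℚ] H) (f : V →ₗ[ℚ] V') (x : V), IsRep ρ ∧ ρ' ∘ₗ f = f.rTensor H ∘ₗ ρ ∧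
      f x = y) : IsRep ρ' where
  coassoc := by
    apply LinearMap.ext
    intro y
    obtain ⟨V, _, _, ρ, f, x, hρ, hf, rfl⟩ := h y
    exact LinearMap.congr_fun (hρ.coassoc_comp f hf) x
  counit := by
    apply LinearMap.ext
    intro y
    obtain ⟨V, _, _, ρ, f, x, hρ, hf, rfl⟩ := h y
    change op ρ' Coalgebra.counit (f x) = f x
    rw [op_map hf, op_counit hρ]

/-! #### Subrepresentations and products -/

/-- The coaction on a subrepresentation. -/
def restrict (ρ : V →ₗ[ℚ] V ⊗[ℚ] H) (W : Submodule ℚ V) (hW : IsSubrep ρ W) : W →ₗ[ℚ] W ⊗[ℚ] H :=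
  (LinearEquiv.ofInjective (W.subtype.rTensor H)
    (rTensor_injective W.injective_subtype)).symm.toLinearMap ∘ₗ
    (ρ ∘ₗ W.subtype).codRestrict _ fun x => hW x x.2

theorem subtype_restrict {W : Submodule ℚ V} (hW : IsSubrep ρ W) :
    ρ ∘ₗ W.subtype = W.subtype.rTensor H ∘ₗ restrict ρ W hW := by
  ext x
  have h := LinearEquiv.ofInjective_apply (W.subtype.rTensor H)
    (h := rTensor_injective W.injective_subtype) (restrict ρ W hW x)
  rw [LinearMap.comp_apply, LinearMap.comp_apply, ← h]
  simp only [restrict, LinearMap.comp_apply, LinearEquiv.coe_coe, LinearEquiv.apply_symm_apply]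
  rfl

theorem IsRep.restrict (h : IsRep ρ) {W : Submodule ℚ V} (hW : IsSubrep ρ W) :
    IsRep (restrict ρ W hW) :=
  h.of_injective (subtype_restrict hW) W.injective_subtype

/-- The product of two representations. -/
def prodRep (ρ : V →ₗ[ℚ] V ⊗[ℚ] H) (ρ' : V' →ₗ[ℚ] V' ⊗[ℚ] H) :
    V × V' →ₗ[ℚ] (V × V') ⊗[ℚ] H :=
  ((LinearMap.inl ℚ V V').rTensor H ∘ₗ ρ).coprod ((LinearMap.inr ℚ V V').rTensor H ∘ₗ ρ')

theorem prodRep_inl : prodRep ρ ρ' ∘ₗ LinearMap.inl ℚ V V' =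
    (LinearMap.inl ℚ V V').rTensor H ∘ₗ ρ := LinearMap.coprod_inl _ _

theorem prodRep_inr : prodRep ρ ρ' ∘ₗ LinearMap.inr ℚ V V' =
    (LinearMap.inr ℚ V V').rTensor H ∘ₗ ρ' := LinearMap.coprod_inr _ _

theorem fst_prodRep : ρ ∘ₗ LinearMap.fst ℚ V V' =
    (LinearMap.fst ℚ V V').rTensor H ∘ₗ prodRep ρ ρ' := by
  apply LinearMap.prod_ext
  · rw [LinearMap.comp_assoc, LinearMap.comp_assoc, prodRep_inl, ← LinearMap.comp_assoc ρ,
      ← LinearMap.rTensor_comp, LinearMap.fst_comp_inl, LinearMap.rTensor_id]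
    rfl
  · rw [LinearMap.comp_assoc, LinearMap.comp_assoc, prodRep_inr, ← LinearMap.comp_assoc ρ',
      ← LinearMap.rTensor_comp, LinearMap.fst_comp_inr, LinearMap.rTensor_zero]
    simp

theorem snd_prodRep : ρ' ∘ₗ LinearMap.snd ℚ V V' =
    (LinearMap.snd ℚ V V').rTensor H ∘ₗ prodRep ρ ρ' := by
  apply LinearMap.prod_ext
  · rw [LinearMap.comp_assoc, LinearMap.comp_assoc, prodRep_inl, ← LinearMap.comp_assoc ρ,
      ← LinearMap.rTensor_comp, LinearMap.snd_comp_inl, LinearMap.rTensor_zero]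
    simp
  · rw [LinearMap.comp_assoc, LinearMap.comp_assoc, prodRep_inr, ← LinearMap.comp_assoc ρ',
      ← LinearMap.rTensor_comp, LinearMap.snd_comp_inr, LinearMap.rTensor_id]
    rfl

theorem op_prodRep (φ : H →ₗ[ℚ] ℚ) (x : V × V') :
    op (prodRep ρ ρ') φ x = (op ρ φ x.1, op ρ' φ x.2) :=
  Prod.ext (op_map fst_prodRep φ x).symm (op_map snd_prodRep φ x).symm

theorem IsRep.prod (h : IsRep ρ) (h' : IsRep ρ') : IsRep (prodRep ρ ρ') where
  coassoc := by
    apply LinearMap.prod_ext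
    · exact h.coassoc_comp (LinearMap.inl ℚ V V') prodRep_inl
    · exact h'.coassoc_comp (LinearMap.inr ℚ V V') prodRep_inr
  counit := by
    refine LinearMap.ext fun x => ?_
    change op (prodRep ρ ρ') Coalgebra.counit x = x
    rw [op_prodRep, op_counit h, op_counit h']

/-! #### Complete reducibility -/

/-- `IsReductive` speaks of spaces in `Type`; a basis transports the representation to ℚ^n and the
complement back. -/
theorem IsReductive.exists_isCompl (hG : IsReductive H) [FiniteDimensional ℚ V] (h : IsRep ρ)
    {W : Submodule ℚ V} (hW : IsSubrep ρ W) : ∃ W', IsSubrep ρ W' ∧ IsCompl W W' := by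
  let e : V ≃ₗ[ℚ] (Fin (Module.finrank ℚ V) → ℚ) := (Module.finBasis ℚ V).equivFun
  let ρ' := e.toLinearMap.rTensor H ∘ₗ ρ ∘ₗ e.symm.toLinearMap
  have he : ρ' ∘ₗ e.toLinearMap = e.toLinearMap.rTensor H ∘ₗ ρ := by
    ext x; simp [ρ']
  have he' : ρ ∘ₗ e.symm.toLinearMap = e.symm.toLinearMap.rTensor H ∘ₗ ρ' := by
    rw [← LinearMap.comp_assoc, ← LinearMap.rTensor_comp]
    simp
  obtain ⟨U, hU, hc⟩ := hG _ ρ' (h.of_injective he' e.symm.injective)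
    (W.map e.toLinearMap) (by
      rw [isSubrep_iff] at *
      rintro φ _ ⟨x, hx, rfl⟩
      exact ⟨_, hW φ x hx, (op_map he φ x).symm⟩)
  refine ⟨U.comap e.toLinearMap, ?_, ?_⟩
  · rw [isSubrep_iff] at *
    intro φ x hx
    change e.toLinearMap (op ρ φ x) ∈ U
    rw [← op_map he]
    exact hU φ _ hx
  · have h1 := (Submodule.orderIsoMapComap e).symm.isCompl hc
    simpa [Submodule.comap_map_eq_of_injective e.injective] using h1

/-- Local finiteness. The orbit of `x` under all operators is finite-dimensional because `ρ x` is a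
finite sum of pure tensors, stable by `op_op`, and contains `x` through the counit. -/
theorem exists_finiteDimensional_subrep (h : IsRep ρ) (x : V) :
    ∃ W : Submodule ℚ V, FiniteDimensional ℚ W ∧ IsSubrep ρ W ∧ x ∈ W := by
  let f : (H →ₗ[ℚ] ℚ) →ₗ[ℚ] V :=
    { toFun φ := op ρ φ x
      map_add' φ ψ := by simp [op, slice, LinearMap.lTensor_add]
      map_smul' r φ := by simp [op, slice, LinearMap.lTensor_smul] }
  obtain ⟨U, _, hU⟩ := exists_finiteDimensional_slice_mem (ρ x)
  refine ⟨LinearMap.range f, Submodule.finiteDimensional_of_le (S₂ := U) ?_, ?_,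
    Coalgebra.counit, op_counit h x⟩
  · rintro _ ⟨φ, rfl⟩
    exact hU φ
  · rw [isSubrep_iff]
    rintro φ _ ⟨ψ, rfl⟩
    exact ⟨conv φ ψ, (op_op h φ ψ x).symm⟩

variable (ρ) in
/-- The algebra of operators on a representation. -/
abbrev opAlgebra : Subalgebra ℚ (Module.End ℚ V) := Algebra.adjoin ℚ (Set.range (op ρ))

/-- Subrepresentations as submodules over the algebra of operators. -/
def subrepSubmodule (W : Submodule ℚ V) (hW : IsSubrep ρ W) : Submodule (opAlgebra ρ) V where
  toAddSubmonoid := W.toAddSubmonoid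
  smul_mem' := by
    rintro ⟨r, hr⟩ x hx
    change r x ∈ W
    rw [isSubrep_iff] at hW
    induction hr using Algebra.adjoin_induction generalizing x with
    | mem r hr => obtain ⟨φ, rfl⟩ := hr; exact hW φ x hx
    | algebraMap r => exact W.smul_mem r hx
    | add r s _ _ h₁ h₂ => exact W.add_mem (h₁ hx) (h₂ hx)
    | mul r s _ _ h₁ h₂ => exact h₁ (h₂ hx)

theorem isSubrep_restrictScalars (W : Submodule (opAlgebra ρ) V) :
    IsSubrep ρ (W.restrictScalars ℚ) := by
  rw [isSubrep_iff]
  intro φ x hx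
  exact W.smul_mem ⟨op ρ φ, Algebra.subset_adjoin ⟨φ, rfl⟩⟩ hx

/-- A module that is a sum of submodules with complemented lattices has one itself. Here these are
the finite-dimensional subrepresentations, which cover `V` by local finiteness. -/
theorem IsReductive.complementedLattice (hG : IsReductive H) (h : IsRep ρ) :
    ComplementedLattice (Submodule (opAlgebra ρ) V) := by
  choose W hW hW' hx using exists_finiteDimensional_subrep h
  refine complementedLattice_of_complementedLattice_Iic (s := Set.univ)
    (f := fun x => subrepSubmodule (W x) (hW' x)) (fun x _ => ⟨?_⟩) ?_
  · rintro ⟨q, hq⟩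
    have := hW x
    let i := (W x).subtype
    have hi := subtype_restrict (hW' x)
    obtain ⟨U, hU, hc⟩ := hG.exists_isCompl (h.restrict (hW' x))
      (W := (q.restrictScalars ℚ).comap i) (by
        have hq' := isSubrep_restrictScalars q
        rw [isSubrep_iff] at *
        intro φ y hy
        change i (op _ φ y) ∈ q.restrictScalars ℚ
        rw [← op_map hi]
        exact hq' φ _ hy)
    have hU' : IsSubrep ρ (U.map i) := by
      rw [isSubrep_iff] at *
      rintro φ _ ⟨y, hy, rfl⟩
      exact ⟨_, hU φ y hy, (op_map hi φ y).symm⟩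
    refine ⟨⟨subrepSubmodule _ hU', ?_⟩, ?_⟩
    · rintro _ ⟨y, _, rfl⟩
      exact y.2
    · rw [isCompl_iff, disjoint_iff, codisjoint_iff]
      constructor
      · rw [eq_bot_iff]
        rintro y ⟨hy, ⟨z, hz, rfl⟩⟩
        have h1 : z ∈ (⊥ : Submodule ℚ (W x)) := hc.inf_eq_bot ▸ ⟨hy, hz⟩
        rw [Submodule.mem_bot] at h1
        rw [h1, map_zero]
        exact zero_mem _
      · rw [eq_top_iff]
        rintro y hy
        obtain ⟨a, ha, b, hb, hab⟩ := Submodule.mem_sup.1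
          (hc.sup_eq_top ▸ Submodule.mem_top : (⟨y, hy⟩ : W x) ∈ _)
        exact Submodule.mem_sup.2 ⟨a, ha, b, ⟨b, hb, rfl⟩, congrArg Subtype.val hab⟩
  · rw [eq_top_iff]
    intro x _
    exact Submodule.mem_iSup_of_mem x (Submodule.mem_iSup_of_mem trivial (hx x))

/-- Subrepresentations of possibly infinite-dimensional representations of a reductive group have
complements. -/
theorem IsReductive.exists_complement (hG : IsReductive H) (h : IsRep ρ) {B Z : Submodule ℚ V}
    (hB : IsSubrep ρ B) (hZ : IsSubrep ρ Z) (hBZ : B ≤ Z) :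
    ∃ U : Submodule ℚ V, IsSubrep ρ U ∧ U ≤ Z ∧ (∀ x ∈ U, x ∈ B → x = 0) ∧
      ∀ z ∈ Z, ∃ x ∈ U, ∃ b ∈ B, z = x + b := by
  have := hG.complementedLattice h
  obtain ⟨C, hC⟩ := ComplementedLattice.exists_isCompl (subrepSubmodule B hB)
  -- Modular law: if z = b + c with z in `Z` and b in `B ≤ Z`, then c already lies in `Z`.
  refine ⟨C.restrictScalars ℚ ⊓ Z, ?_, inf_le_right, ?_, ?_⟩
  · have hC' := isSubrep_restrictScalars C
    rw [isSubrep_iff] at *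
    exact fun φ x hx => ⟨hC' φ x hx.1, hZ φ x hx.2⟩
  · intro x hx hxB
    have h1 : x ∈ (⊥ : Submodule (opAlgebra ρ) V) := hC.inf_eq_bot ▸ ⟨hxB, hx.1⟩
    simpa using h1
  · intro z hz
    obtain ⟨b, hb, c, hc, rfl⟩ := Submodule.mem_sup.1
      (hC.sup_eq_top ▸ Submodule.mem_top : z ∈ _)
    refine ⟨c, ⟨hc, ?_⟩, b, hb, add_comm _ _⟩
    have h1 : b ∈ Z := hBZ hb
    simpa using Z.sub_mem hz h1

end Representations

end CdgaOver

namespace CdgaOver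

/-! ### Weights -/

section Weights

/-- The monomial basis of the Laurent polynomials. -/
def laurentBasis : Module.Basis ℤ ℚ ℚ[T;T⁻¹] := .ofRepr (AddMonoidAlgebra.coeffLinearEquiv ℚ)

theorem laurentBasis_apply (n : ℤ) : laurentBasis n = LaurentPolynomial.T n := rfl

theorem laurentBasis_coord_T (s r : ℤ) :
    laurentBasis.coord s (LaurentPolynomial.T r) = if r = s then 1 else 0 := by
  rw [← laurentBasis_apply, Module.Basis.coord_apply, Module.Basis.repr_self, Finsupp.single_apply]

theorem laurent_ext {V : Type*} [AddCommGroup V] [Module ℚ V] {f g : ℚ[T;T⁻¹] →ₗ[ℚ] V}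
    (h : ∀ n, f (LaurentPolynomial.T n) = g (LaurentPolynomial.T n)) : f = g :=
  laurentBasis.ext h

variable {H : Type u} [CommRing H] [HopfAlgebra ℚ H] (w : CentralCocharacter H)
variable {V : Type v} [AddCommGroup V] [Module ℚ V] {V' : Type w} [AddCommGroup V'] [Module ℚ V']
variable {ρ : V →ₗ[ℚ] V ⊗[ℚ] H} {ρ' : V' →ₗ[ℚ] V' ⊗[ℚ] H}

/-- The linear form on the coordinate ring that projects to the part of weight `s`. -/
def weightForm (s : ℤ) : H →ₗ[ℚ] ℚ :=
  laurentBasis.coord s ∘ₗ (w.comorphism : H →ₗ[ℚ] ℚ[T;T⁻¹])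

theorem op_weightForm (s : ℤ) (x : V) : op ρ (weightForm w s) x =
    slice V (laurentBasis.coord s) ((w.comorphism : H →ₗ[ℚ] ℚ[T;T⁻¹]).lTensor V (ρ x)) := by
  rw [slice_lTensor]; rfl

theorem mem_weightPart_iff {r : ℤ} {x : V} :
    x ∈ weightPart w ρ r ↔ ∀ s, op ρ (weightForm w s) x = if r = s then x else 0 := by
  have h (s : ℤ) : slice V (laurentBasis.coord s) (x ⊗ₜ LaurentPolynomial.T r) =
      if r = s then x else 0 := by
    rw [slice_tmul, laurentBasis_coord_T]
    split_ifs <;> simp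
  change (w.comorphism : H →ₗ[ℚ] ℚ[T;T⁻¹]).lTensor V (ρ x) = x ⊗ₜ LaurentPolynomial.T r ↔ _
  constructor
  · intro hx s
    rw [op_weightForm, hx, h]
  · intro hx
    rw [← sub_eq_zero]
    apply eq_zero_of_slice_coord laurentBasis
    intro s
    rw [map_sub, ← op_weightForm, hx, h, sub_self]

/-- The weight forms are orthogonal idempotents, because each T^n is group-like and the comorphism
of `w` respects comultiplication. -/
theorem conv_weightForm (s r : ℤ) :
    conv (weightForm w s) (weightForm w r) = if s = r then weightForm w r else 0 := by
  have h₁ : (TensorProduct.lid ℚ ℚ).toLinearMap ∘ₗ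
      TensorProduct.map (laurentBasis.coord s) (laurentBasis.coord r) ∘ₗ
      Coalgebra.comul (R := ℚ) (A := ℚ[T;T⁻¹]) = if s = r then laurentBasis.coord r else 0 := by
    apply laurent_ext
    intro n
    have := LaurentPolynomial.comul_C_mul_T_self (1 : ℚ) n
    rw [map_one, one_mul] at this
    simp only [LinearMap.comp_apply, this, TensorProduct.map_tmul, LinearEquiv.coe_coe,
      TensorProduct.lid_tmul, laurentBasis_coord_T]
    by_cases hs : s = r
    · subst hs
      rw [if_pos rfl, laurentBasis_coord_T]
      split_ifs <;> simp
    · rw [if_neg hs, LinearMap.zero_apply]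
      split_ifs <;> simp_all
  have h₂ := CoalgHomClass.map_comp_comul w.comorphism
  rw [conv, weightForm, weightForm, TensorProduct.map_comp, LinearMap.comp_assoc]
  have h₃ := congrArg (fun f => ((TensorProduct.lid ℚ ℚ).toLinearMap ∘ₗ
    TensorProduct.map (laurentBasis.coord s) (laurentBasis.coord r)) ∘ₗ f) h₂
  refine h₃.trans ?_
  rw [LinearMap.comp_assoc, ← LinearMap.comp_assoc _ Coalgebra.comul,
    ← LinearMap.comp_assoc _ (TensorProduct.map _ _ ∘ₗ _), h₁]
  split_ifs
  · rfl
  · rw [LinearMap.zero_comp]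

theorem op_weightForm_mem (h : IsRep ρ) (s : ℤ) (x : V) :
    op ρ (weightForm w s) x ∈ weightPart w ρ s := by
  rw [mem_weightPart_iff]
  intro r
  rw [op_op h, conv_weightForm]
  by_cases hrs : s = r
  · subst hrs; simp
  · rw [if_neg (Ne.symm hrs), if_neg hrs]; simp [op, slice]

/-- Every vector is a finite sum of its weight components: on a finite support the coordinate forms
add up to the counit, as the counit of T^n is 1. -/
theorem mem_of_weightPart_le (h : IsRep ρ) {W : Submodule ℚ V} (x : V)
    (hW : ∀ s, op ρ (weightForm w s) x ∈ W) : x ∈ W := by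
  -- Allowing every larger finite set lets the supports of two summands be merged.
  have key (t : V ⊗[ℚ] ℚ[T;T⁻¹]) : ∃ S : Finset ℤ, ∀ S', S ⊆ S' →
      ∑ s ∈ S', slice V (laurentBasis.coord s) t = slice V Coalgebra.counit t := by
    classical
    induction t with
    | zero => exact ⟨∅, fun _ _ => by simp⟩
    | add a b ha hb =>
      obtain ⟨S, hS⟩ := ha
      obtain ⟨T, hT⟩ := hb
      refine ⟨S ∪ T, fun S' h => ?_⟩
      simp only [map_add, Finset.sum_add_distrib]
      rw [hS _ (Finset.union_subset_left h), hT _ (Finset.union_subset_right h)]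
    | tmul y p =>
      refine ⟨(laurentBasis.repr p).support, fun S' h => ?_⟩
      simp only [slice_tmul]
      rw [← Finset.sum_smul, ← Finset.sum_subset h (by
        intro s _ hs
        simpa using hs)]
      congr 1
  obtain ⟨S, hS⟩ := key ((w.comorphism : H →ₗ[ℚ] ℚ[T;T⁻¹]).lTensor V (ρ x))
  have h₁ : slice V Coalgebra.counit ((w.comorphism : H →ₗ[ℚ] ℚ[T;T⁻¹]).lTensor V (ρ x)) = x := by
    rw [slice_lTensor]
    have h₂ := CoalgHomClass.counit_comp w.comorphism
    refine Eq.trans ?_ (op_counit h x)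
    rw [op, ← h₂]
    rfl
  rw [← h₁, ← hS S subset_rfl]
  refine sum_mem fun s _ => ?_
  rw [← op_weightForm]
  exact hW s

theorem mem_adamsPart_iff {r : ℤ} {x : V} :
    x ∈ adamsPart w ρ r ↔ ∀ s, op ρ (weightForm w (-s)) x = if r = s then x else 0 := by
  rw [adamsPart, mem_weightPart_iff]
  constructor
  · intro h s; rw [h]; simp
  · intro h s
    have := h (-s)
    rw [neg_neg] at this
    rw [this]
    simp [neg_eq_iff_eq_neg]

theorem map_mem_adamsPart {f : V →ₗ[ℚ] V'} (hf : ρ' ∘ₗ f = f.rTensor H ∘ₗ ρ) {r : ℤ} {x : V}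
    (hx : x ∈ adamsPart w ρ r) : f x ∈ adamsPart w ρ' r := by
  rw [mem_adamsPart_iff] at *
  intro s
  rw [op_map hf, hx, apply_ite f, map_zero]

theorem mem_adamsPart_of_map {f : V →ₗ[ℚ] V'} (hf : ρ' ∘ₗ f = f.rTensor H ∘ₗ ρ)
    (hi : Function.Injective f) {r : ℤ} {x : V} (hx : f x ∈ adamsPart w ρ' r) :
    x ∈ adamsPart w ρ r := by
  rw [mem_adamsPart_iff] at *
  intro s
  apply hi
  rw [← op_map hf, hx, apply_ite f, map_zero]

/-- A representation without Adams degrees `≤ 0` is generated by its parts of positive Adams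
degree. -/
theorem mem_of_adamsPart_le (h : IsRep ρ) (h₀ : ∀ r ≤ 0, adamsPart w ρ r = ⊥) {W : Submodule ℚ V}
    (hW : ∀ r > 0, adamsPart w ρ r ≤ W) (x : V) : x ∈ W := by
  refine mem_of_weightPart_le w h x fun s => ?_
  have h₁ : op ρ (weightForm w s) x ∈ adamsPart w ρ (-s) := by
    rw [adamsPart, neg_neg]; exact op_weightForm_mem w h s x
  rcases le_or_gt (-s) 0 with hs | hs
  · rw [h₀ _ hs, Submodule.mem_bot] at h₁
    rw [h₁]
    exact zero_mem _
  · exact hW _ hs h₁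

end Weights

end CdgaOver

namespace CdgaOver

/-! ### Coactions on free graded commutative algebras -/

namespace GradedSym

variable {H : Type u} [CommRing H] [HopfAlgebra ℚ H]
variable {E : ℤ → Type v} [∀ n, AddCommGroup (E n)] [∀ n, Module ℚ (E n)]

/-- The factor `C` is commutative, so it contributes no sign. -/
theorem rTensor_mul_rTensor {B C : Type*} [Semiring B] [Algebra ℚ B] [CommRing C] [Algebra ℚ C]
    {V W : Type*} [AddCommGroup V] [Module ℚ V] [AddCommGroup W] [Module ℚ W]
    {f : V →ₗ[ℚ] B} {g : W →ₗ[ℚ] B} {c : ℚ} (h : ∀ x y, f x * g y = c • (g y * f x))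
    (s : V ⊗[ℚ] C) (t : W ⊗[ℚ] C) :
    f.rTensor C s * g.rTensor C t = c • (g.rTensor C t * f.rTensor C s) := by
  induction s with
  | zero => simp
  | add a b ha hb => rw [map_add, add_mul, mul_add, ha, hb, smul_add]
  | tmul x p =>
    induction t with
    | zero => simp
    | add a b ha hb => rw [map_add, add_mul, mul_add, ha, hb, smul_add]
    | tmul y q =>
      simp only [LinearMap.rTensor_tmul, Algebra.TensorProduct.tmul_mul_tmul]
      rw [h, mul_comm p q, TensorProduct.smul_tmul']

/-- The coaction on `Sym^* E` induced by a coaction on `E`. -/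
def coaction (ρ : ∀ n, E n →ₗ[ℚ] E n ⊗[ℚ] H) : GradedSym E →ₐ[ℚ] GradedSym E ⊗[ℚ] H :=
  lift (E := E) (B := GradedSym E ⊗[ℚ] H) (fun n => (of n).rTensor H ∘ₗ ρ n)
    fun m n x y => rTensor_mul_rTensor (of_mul_of m n) (ρ m x) (ρ n y)

variable {ρ : ∀ n, E n →ₗ[ℚ] E n ⊗[ℚ] H}

@[simp]
theorem coaction_of (n : ℤ) (x : E n) : coaction ρ (of n x) = (of n).rTensor H (ρ n x) :=
  lift_of _ _ n x

theorem coaction_comp_of (n : ℤ) :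
    (coaction ρ).toLinearMap ∘ₗ of n = (of n).rTensor H ∘ₗ ρ n :=
  LinearMap.ext (coaction_of n)

/-- Each axiom is an equality of algebra maps out of `GradedSym E`, so it is inherited from the
generators. -/
theorem isRep_coaction (hρ : ∀ n, IsRep (ρ n)) : IsRep (coaction ρ).toLinearMap where
  coassoc := by
    let f : GradedSym E →ₐ[ℚ] GradedSym E ⊗[ℚ] (H ⊗[ℚ] H) :=
      ((Algebra.TensorProduct.assoc ℚ ℚ ℚ (GradedSym E) H H).toAlgHom.comp
        (Algebra.TensorProduct.map (coaction ρ) (AlgHom.id ℚ H))).comp (coaction ρ)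
    let g : GradedSym E →ₐ[ℚ] GradedSym E ⊗[ℚ] (H ⊗[ℚ] H) :=
      (Algebra.TensorProduct.map (AlgHom.id ℚ (GradedSym E)) (Bialgebra.comulAlgHom ℚ H)).comp
        (coaction ρ)
    have hfg : f = g := hom_ext fun n x =>
      LinearMap.congr_fun ((hρ n).coassoc_comp (of n) (coaction_comp_of n)) x
    exact congrArg AlgHom.toLinearMap hfg
  counit := by
    let f : GradedSym E →ₐ[ℚ] GradedSym E :=
      ((Algebra.TensorProduct.rid ℚ ℚ (GradedSym E)).toAlgHom.comp
        (Algebra.TensorProduct.map (AlgHom.id ℚ (GradedSym E)) (Bialgebra.counitAlgHom ℚ H))).comp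
        (coaction ρ)
    have hf : f = AlgHom.id ℚ _ := hom_ext fun n x =>
      (op_map (coaction_comp_of n) Coalgebra.counit x).trans
        (congrArg (of n) (op_counit (hρ n) x))
    exact congrArg AlgHom.toLinearMap hf

theorem mul_mem_range_rTensor {B : Type*} [Ring B] [Algebra ℚ B] {P Q R : Submodule ℚ B}
    (h : ∀ a ∈ P, ∀ b ∈ Q, a * b ∈ R) {s t : B ⊗[ℚ] H}
    (hs : s ∈ LinearMap.range (P.subtype.rTensor H)) (ht : t ∈ LinearMap.range (Q.subtype.rTensor H)) :
    s * t ∈ LinearMap.range (R.subtype.rTensor H) := by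
  obtain ⟨s, rfl⟩ := hs
  obtain ⟨t, rfl⟩ := ht
  induction s with
  | zero => simp
  | add a b ha hb => rw [map_add, add_mul]; exact add_mem ha hb
  | tmul x p =>
    induction t with
    | zero => simp
    | add a b ha hb => rw [map_add, mul_add]; exact add_mem ha hb
    | tmul y q => exact ⟨⟨_, h x x.2 y y.2⟩ ⊗ₜ (p * q), by simp⟩

theorem isSubrep_deg (ρ : ∀ n, E n →ₗ[ℚ] E n ⊗[ℚ] H) (n : ℤ) :
    IsSubrep (coaction ρ).toLinearMap (deg E n) := by
  let N : ℤ → Submodule ℚ (GradedSym E) := fun n =>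
    (LinearMap.range ((deg E n).subtype.rTensor H)).comap (coaction ρ).toLinearMap
  have : SetLike.GradedMonoid N :=
    { one_mem := by
        change coaction ρ 1 ∈ LinearMap.range ((deg E 0).subtype.rTensor H)
        rw [map_one]
        exact ⟨⟨1, SetLike.GradedOne.one_mem⟩ ⊗ₜ 1, rfl⟩
      mul_mem := fun i j a b ha hb => by
        change coaction ρ (a * b) ∈ LinearMap.range ((deg E (i + j)).subtype.rTensor H)
        rw [map_mul]
        exact mul_mem_range_rTensor (fun a ha b hb => SetLike.mul_mem_graded ha hb) ha hb }
  refine deg_le N (fun n x => ?_) n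
  change coaction ρ (of n x) ∈ LinearMap.range ((deg E n).subtype.rTensor H)
  rw [coaction_of]
  refine ⟨((of n).codRestrict (deg E n) (of_mem_deg n)).rTensor H (ρ n x), ?_⟩
  rw [← LinearMap.comp_apply, ← LinearMap.rTensor_comp]
  rfl

theorem rTensor_der_mul (D : ∀ n, E n →ₗ[ℚ] GradedSym E) (hD : ∀ n x, D n x ∈ deg E (n + 1))
    (s t : GradedSym E ⊗[ℚ] H) : (der D hD).rTensor H (s * t) = (der D hD).rTensor H s * t +
      Algebra.TensorProduct.map (twist E 1) (AlgHom.id ℚ H) s * (der D hD).rTensor H t := by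
  induction s with
  | zero => simp
  | add a b ha hb =>
    simp only [map_add, add_mul, ha, hb]
    abel
  | tmul x p =>
    induction t with
    | zero => simp
    | add a b ha hb =>
      simp only [map_add, mul_add, ha, hb]
      abel
    | tmul y q =>
      simp only [LinearMap.rTensor_tmul, Algebra.TensorProduct.tmul_mul_tmul, der_mul,
        TensorProduct.add_tmul, Algebra.TensorProduct.map_tmul, AlgHom.id_apply]

theorem coaction_twist (a : GradedSym E) : coaction ρ (twist E 1 a) =
    Algebra.TensorProduct.map (twist E 1) (AlgHom.id ℚ H) (coaction ρ a) := by
  rw [← AlgHom.comp_apply, ← AlgHom.comp_apply]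
  congr 1
  apply hom_ext
  intro n x
  rw [AlgHom.comp_apply, AlgHom.comp_apply, twist_of, map_smul, coaction_of]
  generalize ρ n x = t
  induction t with
  | zero => simp
  | add a b ha hb => rw [map_add, map_add, smul_add, ha, hb]
  | tmul y q => simp [TensorProduct.smul_tmul']

/-- Both composites are derivations along `coaction ρ` and its composite with `twist E 1`; they are
compared on generators. -/
theorem coaction_der {D : ∀ n, E n →ₗ[ℚ] GradedSym E} {hD : ∀ n x, D n x ∈ deg E (n + 1)}
    (h : ∀ n, (coaction ρ).toLinearMap ∘ₗ D n = (D n).rTensor H ∘ₗ ρ n) :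
    (coaction ρ).toLinearMap ∘ₗ der D hD = (der D hD).rTensor H ∘ₗ (coaction ρ).toLinearMap := by
  refine linearMap_ext_of_leibniz (E := E) (B := GradedSym E ⊗[ℚ] H) (coaction ρ) ((coaction ρ).comp (twist E 1)) _ _ ?_ ?_ ?_
  · intro a b
    change coaction ρ (der D hD (a * b)) = coaction ρ (der D hD a) * coaction ρ b +
      coaction ρ (twist E 1 a) * coaction ρ (der D hD b)
    rw [der_mul, map_add, map_mul, map_mul]
  · intro a b
    change (der D hD).rTensor H (coaction ρ (a * b)) = (der D hD).rTensor H (coaction ρ a) *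
      coaction ρ b + coaction ρ (twist E 1 a) * (der D hD).rTensor H (coaction ρ b)
    rw [map_mul, rTensor_der_mul, coaction_twist]
  · intro n x
    change coaction ρ (der D hD (of n x)) = (der D hD).rTensor H (coaction ρ (of n x))
    rw [der_of, coaction_of, ← LinearMap.comp_apply ((der D hD).rTensor H),
      ← LinearMap.rTensor_comp]
    have h₁ : der D hD ∘ₗ of n = D n := LinearMap.ext fun x => der_of D hD n x
    rw [h₁]
    exact LinearMap.congr_fun (h n) x

/-! ### Generators of positive degree -/

variable (E) in
/-- The augmentation killing the generators. -/
def aug : GradedSym E →ₐ[ℚ] ℚ := lift (fun _ => 0) (by simp)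

@[simp]
theorem aug_of (n : ℤ) (x : E n) : aug E (of n x) = 0 := lift_of _ _ n x

theorem aug_of_mem {n : ℤ} (hn : n ≠ 0) {a : GradedSym E} (ha : a ∈ deg E n) : aug E a = 0 := by
  let N : ℤ → Submodule ℚ (GradedSym E) := fun n => ⨅ _ : n ≠ 0, LinearMap.ker (aug E).toLinearMap
  have hN : ∀ {n a}, a ∈ N n ↔ (n ≠ 0 → aug E a = 0) := by simp [N]
  have : SetLike.GradedMonoid N :=
    { one_mem := by rw [hN]; simp
      mul_mem := fun i j a b ha hb => by
        rw [hN] at *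
        intro hij
        rw [map_mul]
        by_cases hi : i = 0
        · rw [hb (by omega), mul_zero]
        · rw [ha hi, zero_mul] }
  exact hN.1 (deg_le N (fun n x => hN.2 fun _ => aug_of n x) n ha) hn

/-- The unit splits off as a complex because no generator has degree -1, so no differential of a
generator reaches degree 0. -/
theorem aug_der {D : ∀ n, E n →ₗ[ℚ] GradedSym E} {hD : ∀ n x, D n x ∈ deg E (n + 1)}
    (hE : ∀ n ≤ 0, Subsingleton (E n)) (a : GradedSym E) : aug E (der D hD a) = 0 := by
  refine LinearMap.congr_fun (linearMap_ext_of_leibniz (aug E) ((aug E).comp (twist E 1))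
    ((aug E).toLinearMap ∘ₗ der D hD) 0 ?_ ?_ ?_) a
  · intro a b
    change aug E (der D hD (a * b)) = aug E (der D hD a) * aug E b +
      aug E (twist E 1 a) * aug E (der D hD b)
    rw [der_mul, map_add, map_mul, map_mul]
  · simp
  · intro n x
    change aug E (der D hD (of n x)) = 0
    rw [der_of]
    rcases le_or_gt n 0 with hn | hn
    · have := hE n hn
      rw [Subsingleton.elim x 0, map_zero, map_zero]
    · exact aug_of_mem (by omega) (hD n x)

theorem rTensor_aug_coaction (a : GradedSym E) :
    (aug E).toLinearMap.rTensor H (coaction ρ a) = aug E a ⊗ₜ[ℚ] (1 : H) := by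
  let f : GradedSym E →ₐ[ℚ] ℚ ⊗[ℚ] H :=
    (Algebra.TensorProduct.map (aug E) (AlgHom.id ℚ H)).comp (coaction ρ)
  let g : GradedSym E →ₐ[ℚ] ℚ ⊗[ℚ] H := Algebra.TensorProduct.includeLeft.comp (aug E)
  have hfg : f = g := by
    apply hom_ext
    intro n x
    change (aug E).toLinearMap.rTensor H (coaction ρ (of n x)) = aug E (of n x) ⊗ₜ[ℚ] (1 : H)
    rw [coaction_of, ← LinearMap.comp_apply, ← LinearMap.rTensor_comp, aug_of,
      TensorProduct.zero_tmul]
    have h₁ : (aug E).toLinearMap ∘ₗ of n = 0 := LinearMap.ext (aug_of n)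
    rw [h₁, LinearMap.rTensor_zero, LinearMap.zero_apply]
  exact DFunLike.congr_fun hfg a

/-- The two clauses need each other: a nonzero product of degree 0 has both factors of degree 0 only
because negative degrees vanish. -/
theorem mem_deg_of_nonpos (hE : ∀ n ≤ 0, Subsingleton (E n)) {n : ℤ} {a : GradedSym E}
    (ha : a ∈ deg E n) : (n < 0 → a = 0) ∧ (n = 0 → a ∈ Submodule.span ℚ {(1 : GradedSym E)}) := by
  let N : ℤ → Submodule ℚ (GradedSym E) := fun n =>
    (⨅ _ : n < 0, ⊥) ⊓ ⨅ _ : n = 0, Submodule.span ℚ {(1 : GradedSym E)}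
  have hN : ∀ {n a}, a ∈ N n ↔ (n < 0 → a = 0) ∧
      (n = 0 → a ∈ Submodule.span ℚ {(1 : GradedSym E)}) := by simp [N]
  have : SetLike.GradedMonoid N :=
    { one_mem := by
        rw [hN]
        exact ⟨fun h => absurd h (by simp), fun _ => Submodule.mem_span_singleton_self _⟩
      mul_mem := fun i j a b ha hb => by
        rw [hN] at *
        by_cases hi : i < 0
        · rw [ha.1 hi, zero_mul]; simp
        by_cases hj : j < 0
        · rw [hb.1 hj, mul_zero]; simp
        refine ⟨fun h => by omega, fun h => ?_⟩
        obtain ⟨r, rfl⟩ := Submodule.mem_span_singleton.1 (ha.2 (by omega))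
        rw [smul_mul_assoc, one_mul]
        exact Submodule.smul_mem _ _ (hb.2 (by omega)) }
  refine hN.1 (deg_le N (fun n x => hN.2 ?_) n ha)
  rcases le_or_gt n 0 with hn | hn
  · have := hE n hn
    rw [Subsingleton.elim x 0, map_zero]
    simp
  · exact ⟨fun h => by omega, fun h => by omega⟩

end GradedSym

end CdgaOver

namespace CdgaOver

namespace Cdga

variable {H : Type u} [CommRing H] [HopfAlgebra ℚ H] {A M : Cdga.{u, v} H}

theorem koszul_comm_of_mem {m n : ℤ} {a b : A} (ha : a ∈ A.deg m) (hb : b ∈ A.deg n) :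
    a * b = koszul m n • (b * a) := by
  rw [koszul_smul]
  exact A.graded_comm m n a ha b hb

theorem eq_zero_of_mem_deg {m n : ℤ} (hmn : m ≠ n) {a : A} (hm : a ∈ A.deg m)
    (hn : a ∈ A.deg n) : a = 0 := by
  by_contra h
  exact hmn (DirectSum.degree_eq_of_mem_mem A.deg hm hn h)

/-! ### Adams connectedness -/

section Adams

variable (w : CentralCocharacter H)

theorem mem_adams_iff {r : ℤ} {a : A} : a ∈ A.adams w r ↔
    (w.comorphism : H →ₗ[ℚ] ℚ[T;T⁻¹]).lTensor A (A.ρ a) = a ⊗ₜ LaurentPolynomial.T (-r) := Iff.rfl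

theorem one_mem_adams : (1 : A) ∈ A.adams w 0 := by
  rw [mem_adams_iff, map_one, Algebra.TensorProduct.one_def]
  simp

theorem mul_mem_adams {r s : ℤ} {a b : A} (ha : a ∈ A.adams w r) (hb : b ∈ A.adams w s) :
    a * b ∈ A.adams w (r + s) := by
  rw [mem_adams_iff] at *
  have h (x y : A ⊗[ℚ] H) : (w.comorphism : H →ₗ[ℚ] ℚ[T;T⁻¹]).lTensor A (x * y) =
      (w.comorphism : H →ₗ[ℚ] ℚ[T;T⁻¹]).lTensor A x *
        (w.comorphism : H →ₗ[ℚ] ℚ[T;T⁻¹]).lTensor A y :=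
    map_mul (Algebra.TensorProduct.map (AlgHom.id ℚ A) (w.comorphism : H →ₐ[ℚ] ℚ[T;T⁻¹])) x y
  rw [map_mul, h, ha, hb, Algebra.TensorProduct.tmul_mul_tmul, ← LaurentPolynomial.T_add]
  congr 2
  ring

/-- The Adams degree 0 part is ℚ·1, which sits in cohomological degree 0. -/
theorem AdamsConnected.eq_zero {w : CentralCocharacter H} (h : A.AdamsConnected w) {r n : ℤ}
    (hr : r ≤ 0) (hn : n ≠ 0) {a : A} (ha : a ∈ A.adams w r) (hna : a ∈ A.deg n) : a = 0 := by
  rcases hr.lt_or_eq with hr | rfl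
  · rw [h.1 r hr] at ha
    exact ha
  · rw [h.2, Submodule.mem_span_singleton] at ha
    obtain ⟨q, rfl⟩ := ha
    exact eq_zero_of_mem_deg hn hna (Submodule.smul_mem _ _ A.one_mem_deg)

/-- The sum `Q` of the positive Adams parts is closed under products, so the algebra is ℚ·1 + `Q`;
the projection to an Adams degree ≤ 0 kills `Q`. -/
theorem adamsConnected_of_generators (S : Set A) (hS : Algebra.adjoin ℚ S = ⊤)
    (h : ∀ a ∈ S, a ∈ ⨆ r : {r : ℤ // 0 < r}, A.adams w r) : A.AdamsConnected w := by
  set Q := ⨆ r : {r : ℤ // 0 < r}, A.adams w r with hQ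
  have hmul : ∀ a ∈ Q, ∀ b ∈ Q, a * b ∈ Q := by
    intro a ha b hb
    induction ha using Submodule.iSup_induction' with
    | zero => rw [zero_mul]; exact zero_mem _
    | add x y _ _ hx hy => rw [add_mul]; exact add_mem hx hy
    | mem r x hx =>
      induction hb using Submodule.iSup_induction' with
      | zero => rw [mul_zero]; exact zero_mem _
      | add x y _ _ hx hy => rw [mul_add]; exact add_mem hx hy
      | mem s y hy =>
        exact Submodule.mem_iSup_of_mem ⟨r + s, add_pos r.2 s.2⟩ (mul_mem_adams w hx hy)
  have htop : ∀ a : A, ∃ c : ℚ, ∃ q ∈ Q, a = c • 1 + q := by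
    intro a
    have ha : a ∈ Algebra.adjoin ℚ S := hS ▸ Algebra.mem_top
    induction ha using Algebra.adjoin_induction with
    | mem x hx => exact ⟨0, x, h x hx, by simp⟩
    | algebraMap r => exact ⟨r, 0, zero_mem _, by rw [Algebra.algebraMap_eq_smul_one, add_zero]⟩
    | add x y _ _ hx hy =>
      obtain ⟨c, p, hp, rfl⟩ := hx
      obtain ⟨d, q, hq, rfl⟩ := hy
      exact ⟨c + d, p + q, add_mem hp hq, by rw [add_smul]; abel⟩
    | mul x y _ _ hx hy =>
      obtain ⟨c, p, hp, rfl⟩ := hx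
      obtain ⟨d, q, hq, rfl⟩ := hy
      refine ⟨c * d, c • q + d • p + p * q,
        add_mem (add_mem (Q.smul_mem _ hq) (Q.smul_mem _ hp)) (hmul p hp q hq), ?_⟩
      simp only [add_mul, mul_add, smul_mul_assoc, mul_smul_comm, one_mul, mul_one, smul_add,
        smul_smul, mul_comm d c]
      abel
  have hproj : ∀ r ≤ 0, ∀ q ∈ Q, op A.ρ.toLinearMap (weightForm w (-r)) q = 0 := by
    intro r hr q hq
    induction hq using Submodule.iSup_induction' with
    | zero => rw [map_zero]
    | add x y _ _ hx hy => rw [map_add, hx, hy, add_zero]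
    | mem s x hx =>
      have hs := s.2
      rw [(mem_adamsPart_iff w).1 hx, if_neg (by omega)]
  have hone (r : ℤ) := (mem_adamsPart_iff w).1 (one_mem_adams (A := A) w) r
  constructor
  · intro r hr
    rw [eq_bot_iff]
    intro a ha
    have h₁ := (mem_adamsPart_iff w).1 ha r
    obtain ⟨c, q, hq, rfl⟩ := htop a
    rw [map_add, map_smul, hone, hproj r hr.le q hq, if_neg hr.ne', if_pos rfl] at h₁
    rw [Submodule.mem_bot, ← h₁]
    simp
  · apply le_antisymm
    · intro a ha
      have h₁ := (mem_adamsPart_iff w).1 ha 0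
      obtain ⟨c, q, hq, rfl⟩ := htop a
      rw [map_add, map_smul, hone, hproj 0 le_rfl q hq, if_pos rfl, if_pos rfl, add_zero] at h₁
      rw [← h₁]
      exact Submodule.smul_mem _ _ (Submodule.mem_span_singleton_self _)
    · rw [Submodule.span_singleton_le_iff_mem]
      exact one_mem_adams w

end Adams

end Cdga

/-! ### Free cdgas -/

open GradedSym in
/-- A cdga over `G` whose underlying algebra is the free graded commutative algebra on an
explicitly given graded representation in positive degrees. -/
structure FreeCdga (H : Type u) [CommRing H] [HopfAlgebra ℚ H] where
  E : ℤ → Type v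
  [addCommGroup : ∀ n, AddCommGroup (E n)]
  [module : ∀ n, Module ℚ (E n)]
  subsingleton : ∀ n ≤ 0, Subsingleton (E n)
  ρ : ∀ n, E n →ₗ[ℚ] E n ⊗[ℚ] H
  isRep : ∀ n, IsRep (ρ n)
  d : ∀ n, E n →ₗ[ℚ] GradedSym E
  d_mem : ∀ n x, d n x ∈ deg E (n + 1)
  d_d : ∀ n x, der d d_mem (d n x) = 0
  d_equivariant : ∀ n, (coaction ρ).toLinearMap ∘ₗ d n = (d n).rTensor H ∘ₗ ρ n

namespace FreeCdga

open GradedSym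

variable {H : Type u} [CommRing H] [HopfAlgebra ℚ H]

attribute [instance] FreeCdga.addCommGroup FreeCdga.module

variable (D : FreeCdga.{u, v} H) {A : Cdga.{u, v} H}

/-- The underlying cdga. -/
def toCdga : Cdga.{u, v} H where
  carrier := GradedSym D.E
  deg := deg D.E
  ρ := coaction D.ρ
  d := der D.d D.d_mem
  graded_comm m n a ha b hb := by
    rw [← koszul_smul]
    exact GradedSym.graded_comm ha hb
  isRep := isRep_coaction D.isRep
  deg_subrep := isSubrep_deg D.ρ
  d_mem n a ha := der_mem D.d D.d_mem ha
  d_d := der_der D.d D.d_mem D.d_d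
  d_equivariant := coaction_der D.d_equivariant
  leibniz n a ha b := by
    rw [negOnePow_smul_eq, der_mul, twist_of_mem 1 ha, smul_mul_assoc, koszul, one_mul]
  unit_split := ⟨(aug D.E).toLinearMap, map_one (aug D.E), fun n hn a ha => aug_of_mem hn ha,
    aug_der D.subsingleton, rTensor_aug_coaction⟩

/-- The generators of degree `n`. -/
def gen (n : ℤ) : D.E n →ₗ[ℚ] D.toCdga := GradedSym.of (E := D.E) n

theorem gen_mem (n : ℤ) (x : D.E n) : D.gen n x ∈ D.toCdga.deg n := of_mem_deg n x

theorem d_gen (n : ℤ) (x : D.E n) : D.toCdga.d (D.gen n x) = D.d n x := der_of D.d D.d_mem n x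

theorem ρ_gen (n : ℤ) :
    D.toCdga.ρ.toLinearMap ∘ₗ D.gen n = (D.gen n).rTensor H ∘ₗ D.ρ n := coaction_comp_of n

theorem adjoin_gen : Algebra.adjoin ℚ {a : D.toCdga | ∃ n x, D.gen n x = a} = ⊤ :=
  adjoin_of (E := D.E)

variable {D} in
theorem algHom_ext {B : Type w} [Semiring B] [Algebra ℚ B] {f g : D.toCdga →ₐ[ℚ] B}
    (h : ∀ n x, f (D.gen n x) = g (D.gen n x)) : f = g :=
  GradedSym.hom_ext (E := D.E) h

variable {D} in
theorem eq_zero_of_mem_deg_neg {n : ℤ} (hn : n < 0) {a : D.toCdga} (ha : a ∈ D.toCdga.deg n) :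
    a = 0 := (mem_deg_of_nonpos D.subsingleton ha).1 hn

variable {D} in
theorem mem_span_one_of_mem_deg_zero {a : D.toCdga} (ha : a ∈ D.toCdga.deg 0) :
    a ∈ Submodule.span ℚ {(1 : D.toCdga)} := (mem_deg_of_nonpos D.subsingleton ha).2 rfl

/-- A multiplicative family of subspaces containing the generators contains all homogeneous
elements. -/
theorem deg_le (N : ℤ → Submodule ℚ D.toCdga) (h₁ : 1 ∈ N 0) (hN : ∀ n x, D.gen n x ∈ N n)
    (hmul : ∀ i j a b, a ∈ N i → b ∈ N j → a * b ∈ N (i + j)) (n : ℤ) : D.toCdga.deg n ≤ N n :=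
  let N' : ℤ → Submodule ℚ (GradedSym D.E) := N
  have : SetLike.GradedMonoid N' := { one_mem := h₁, mul_mem := fun i j a b => hmul i j a b }
  GradedSym.deg_le N' hN n

/-- The generating spaces are the images of the `D.E n`. The inverse of `symToAlg` comes from the
universal property, so injectivity of `gen` plays no role. -/
theorem isFree : D.toCdga.IsFree := by
  let E' : ℤ → Submodule ℚ D.toCdga := fun n => LinearMap.range (D.gen n)
  have hE' : ∀ n, E' n ≤ D.toCdga.deg n := by
    rintro n _ ⟨x, rfl⟩
    exact D.gen_mem n x
  refine ⟨E', hE', fun n => ?_, fun n hn => ?_, ?_⟩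
  · rw [isSubrep_iff]
    rintro φ _ ⟨x, rfl⟩
    exact ⟨_, (op_map (D.ρ_gen n) φ x).symm⟩
  · have := D.subsingleton n hn
    rw [eq_bot_iff]
    rintro _ ⟨x, rfl⟩
    rw [Subsingleton.elim x 0, map_zero]
    exact zero_mem _
  · have hsym : ∀ n (y : E' n), D.toCdga.symToAlg E' hE' (of n y) = y := by
      intro n y
      rw [of_eq_mk, Cdga.symToAlg, RingQuot.liftAlgHom_mkAlgHom_apply]
      simp [CdgaOver.gen]
    let g : D.toCdga →ₐ[ℚ] GradedSym (fun n => E' n) :=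
      lift (E := D.E) (B := GradedSym (fun n => E' n))
        (fun n => of n ∘ₗ (D.gen n).rangeRestrict) fun m n x y => of_mul_of m n _ _
    have hg : ∀ n x, g (D.gen n x) = of (E := fun n => E' n) n ⟨D.gen n x, x, rfl⟩ :=
      fun n x => lift_of _ _ n x
    have h₁ : (D.toCdga.symToAlg E' hE').comp g = AlgHom.id ℚ _ :=
      algHom_ext fun n x => by rw [AlgHom.comp_apply, hg, hsym]; rfl
    have h₂ : g.comp (D.toCdga.symToAlg E' hE') = AlgHom.id ℚ _ := by
      apply GradedSym.hom_ext
      rintro n ⟨_, x, rfl⟩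
      rw [AlgHom.comp_apply, hsym, hg]
      rfl
    exact Function.bijective_iff_has_inverse.2
      ⟨g, fun a => DFunLike.congr_fun h₂ a, fun a => DFunLike.congr_fun h₁ a⟩

theorem adamsConnected (w : CentralCocharacter H)
    (h : ∀ n, ∀ r ≤ 0, adamsPart w (D.ρ n) r = ⊥) : D.toCdga.AdamsConnected w := by
  refine Cdga.adamsConnected_of_generators w _ D.adjoin_gen ?_
  rintro _ ⟨n, x, rfl⟩
  refine mem_of_adamsPart_le w (D.isRep n) (h n)
    (W := (⨆ r : {r : ℤ // 0 < r}, D.toCdga.adams w r).comap (D.gen n)) (fun r hr y hy => ?_) x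
  exact Submodule.mem_iSup_of_mem ⟨r, hr⟩ (map_mem_adamsPart w (D.ρ_gen n) hy)

section Hom

variable {D}

/-- The algebra map from a free cdga with given values on the generators. -/
def liftAlgHom (f : ∀ n, D.E n →ₗ[ℚ] A) (hf : ∀ n x, f n x ∈ A.deg n) : D.toCdga →ₐ[ℚ] A :=
  lift (E := D.E) (B := A) f fun m n x y => Cdga.koszul_comm_of_mem (hf m x) (hf n y)

@[simp]
theorem liftAlgHom_gen (f : ∀ n, D.E n →ₗ[ℚ] A) (hf : ∀ n x, f n x ∈ A.deg n) (n : ℤ)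
    (x : D.E n) : liftAlgHom f hf (D.gen n x) = f n x := lift_of _ _ n x

/-- An algebra map that respects all structures on the generators is a map of cdgas. -/
def homOfGen (s : D.toCdga →ₐ[ℚ] A) (hs : ∀ n x, s (D.gen n x) ∈ A.deg n)
    (hd : ∀ n x, s (D.d n x) = A.d (s (D.gen n x)))
    (hρ : ∀ n, A.ρ.toLinearMap ∘ₗ (s.toLinearMap ∘ₗ D.gen n) =
      (s.toLinearMap ∘ₗ D.gen n).rTensor H ∘ₗ D.ρ n) : Cdga.Hom D.toCdga A where
  toAlgHom := s
  map_deg n a ha := by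
    refine D.deg_le (fun n => (A.deg n).comap s.toLinearMap) ?_ hs ?_ n ha
    · simpa using A.one_mem_deg
    · intro i j a b ha hb
      simpa using SetLike.mul_mem_graded (A := A.deg) ha hb
  map_d := by
    have hdeg : ∀ n a, a ∈ D.toCdga.deg n → s a ∈ A.deg n := by
      intro n a ha
      refine D.deg_le (fun n => (A.deg n).comap s.toLinearMap) ?_ hs ?_ n ha
      · simpa using A.one_mem_deg
      · intro i j a b ha hb
        simpa using SetLike.mul_mem_graded (A := A.deg) ha hb
    let s' : GradedSym D.E →ₐ[ℚ] A := s
    have key : s'.toLinearMap ∘ₗ der D.d D.d_mem = A.d ∘ₗ s'.toLinearMap := by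
      refine linearMap_ext_of_leibniz (E := D.E) (B := A) s' (s'.comp (twist D.E 1)) _ _ ?_ ?_ ?_
      · intro a b
        simp only [LinearMap.comp_apply, AlgHom.toLinearMap_apply, AlgHom.comp_apply, der_mul,
          map_add, map_mul]
      · intro a b
        simp only [LinearMap.comp_apply, AlgHom.toLinearMap_apply, AlgHom.comp_apply, map_mul]
        -- The Leibniz rule of `A` is available for a homogeneous left factor only.
        induction a using homogeneous_induction with
        | zero => simp
        | add a a' h h' =>
          simp only [map_add, add_mul, h, h']
          abel
        | homogeneous n a ha =>
          have hsa : s' a ∈ A.deg n := hdeg n a ha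
          rw [A.leibniz n _ hsa, twist_of_mem 1 ha, map_smul, smul_mul_assoc,
            koszul_smul, one_mul]
      · intro n x
        exact (congrArg s (D.d_gen n x)).trans (hd n x)
    exact LinearMap.congr_fun key
  equivariant := by
    let f : D.toCdga →ₐ[ℚ] A ⊗[ℚ] H := A.ρ.comp s
    let g : D.toCdga →ₐ[ℚ] A ⊗[ℚ] H :=
      (Algebra.TensorProduct.map s (AlgHom.id ℚ H)).comp D.toCdga.ρ
    have hfg : f = g := by
      apply algHom_ext
      intro n x
      refine (LinearMap.congr_fun (hρ n) x).trans ?_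
      rw [LinearMap.rTensor_comp, LinearMap.comp_assoc, ← D.ρ_gen n]
      rfl
    exact congrArg AlgHom.toLinearMap hfg

end Hom

end FreeCdga

end CdgaOver

namespace CdgaOver

/-! ### Functoriality in the generators, and free cdgas over `A` -/

namespace GradedSym

variable {H : Type u} [CommRing H] [HopfAlgebra ℚ H]
variable {E : ℤ → Type v} [∀ n, AddCommGroup (E n)] [∀ n, Module ℚ (E n)]
variable {F : ℤ → Type v} [∀ n, AddCommGroup (F n)] [∀ n, Module ℚ (F n)]
variable {K : ℤ → Type v} [∀ n, AddCommGroup (K n)] [∀ n, Module ℚ (K n)]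

theorem map_map (f : ∀ n, E n →ₗ[ℚ] F n) (g : ∀ n, F n →ₗ[ℚ] K n) (a : GradedSym E) :
    map g (map f a) = map (fun n => g n ∘ₗ f n) a := by
  rw [← AlgHom.comp_apply]
  congr 1
  apply hom_ext
  intro n x
  simp

theorem map_twist (f : ∀ n, E n →ₗ[ℚ] F n) (a : GradedSym E) :
    map f (twist E 1 a) = twist F 1 (map f a) := by
  rw [← AlgHom.comp_apply, ← AlgHom.comp_apply]
  congr 1
  apply hom_ext
  intro n x
  simp

theorem map_der (f : ∀ n, E n →ₗ[ℚ] F n) {D : ∀ n, E n →ₗ[ℚ] GradedSym E}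
    {hD : ∀ n x, D n x ∈ deg E (n + 1)} {D' : ∀ n, F n →ₗ[ℚ] GradedSym F}
    {hD' : ∀ n x, D' n x ∈ deg F (n + 1)} (h : ∀ n x, map f (D n x) = D' n (f n x))
    (a : GradedSym E) : map f (der D hD a) = der D' hD' (map f a) := by
  refine LinearMap.congr_fun (linearMap_ext_of_leibniz (E := E) (B := GradedSym F) (map f)
    ((map f).comp (twist E 1)) ((map f).toLinearMap ∘ₗ der D hD)
    (der D' hD' ∘ₗ (map f).toLinearMap) ?_ ?_ ?_) a
  · intro a b
    simp only [LinearMap.comp_apply, AlgHom.toLinearMap_apply, AlgHom.comp_apply, der_mul,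
      map_add, map_mul]
  · intro a b
    simp only [LinearMap.comp_apply, AlgHom.toLinearMap_apply, AlgHom.comp_apply, der_mul,
      map_mul, map_twist]
  · intro n x
    simp [h]

theorem coaction_map (f : ∀ n, E n →ₗ[ℚ] F n) {ρ : ∀ n, E n →ₗ[ℚ] E n ⊗[ℚ] H}
    {ρ' : ∀ n, F n →ₗ[ℚ] F n ⊗[ℚ] H} (h : ∀ n, ρ' n ∘ₗ f n = (f n).rTensor H ∘ₗ ρ n) :
    (coaction ρ').toLinearMap ∘ₗ (map f).toLinearMap =
      (map f).toLinearMap.rTensor H ∘ₗ (coaction ρ).toLinearMap := by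
  let φ : GradedSym E →ₐ[ℚ] GradedSym F ⊗[ℚ] H := (coaction ρ').comp (map f)
  let ψ : GradedSym E →ₐ[ℚ] GradedSym F ⊗[ℚ] H :=
    (Algebra.TensorProduct.map (map f) (AlgHom.id ℚ H)).comp (coaction ρ)
  have hφψ : φ = ψ := by
    apply hom_ext
    intro n x
    change coaction ρ' (map f (of n x)) = (map f).toLinearMap.rTensor H (coaction ρ (of n x))
    rw [map_of, coaction_of, coaction_of, ← LinearMap.comp_apply (ρ' n), h, LinearMap.comp_apply,
      ← LinearMap.rTensor_comp_apply, ← LinearMap.rTensor_comp_apply]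
    congr 2
    ext x
    simp
  exact congrArg AlgHom.toLinearMap hφψ

end GradedSym

open GradedSym CategoryTheory

variable {H : Type u} [CommRing H] [HopfAlgebra ℚ H]

/-- A free cdga over `G` with a map to `A`. -/
structure FreeOver (A : Cdga.{u, v} H) extends FreeCdga.{u, v} H where
  f : ∀ n, E n →ₗ[ℚ] A
  f_mem : ∀ n x, f n x ∈ A.deg n
  f_d : ∀ n x, FreeCdga.liftAlgHom (D := toFreeCdga) f f_mem (d n x) = A.d (f n x)
  f_equivariant : ∀ n, A.ρ.toLinearMap ∘ₗ f n = (f n).rTensor H ∘ₗ ρ n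

namespace FreeOver

variable {A : Cdga.{u, v} H} (X Y Z : FreeOver A)

/-- The structure map to `A`. -/
def hom : Cdga.Hom X.toCdga A :=
  FreeCdga.homOfGen (FreeCdga.liftAlgHom X.f X.f_mem)
    (fun n x => by rw [FreeCdga.liftAlgHom_gen]; exact X.f_mem n x)
    (fun n x => by rw [FreeCdga.liftAlgHom_gen]; exact X.f_d n x)
    (fun n => by
      have : (FreeCdga.liftAlgHom X.f X.f_mem).toLinearMap ∘ₗ X.gen n = X.f n :=
        LinearMap.ext fun x => FreeCdga.liftAlgHom_gen X.f X.f_mem n x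
      rw [this]
      exact X.f_equivariant n)

theorem hom_gen (n : ℤ) (x : X.E n) : X.hom.toAlgHom (X.gen n x) = X.f n x :=
  FreeCdga.liftAlgHom_gen X.f X.f_mem n x

/-- Injective maps of free cdgas over `A`, given by maps of the generators. -/
@[ext]
structure Emb where
  j : ∀ n, X.E n →ₗ[ℚ] Y.E n
  injective : ∀ n, Function.Injective (j n)
  equivariant : ∀ n, Y.ρ n ∘ₗ j n = (j n).rTensor H ∘ₗ X.ρ n
  map_d : ∀ n x, GradedSym.map j (X.d n x) = Y.d n (j n x)
  f_j : ∀ n x, Y.f n (j n x) = X.f n x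

namespace Emb

variable {X Y Z}

/-- The identity. -/
def id (X : FreeOver A) : Emb X X where
  j _ := LinearMap.id
  injective _ := Function.injective_id
  equivariant n := by rw [LinearMap.rTensor_id]; rfl
  map_d n x := by
    have : GradedSym.map (fun n => LinearMap.id (R := ℚ) (M := X.E n)) = AlgHom.id ℚ _ :=
      GradedSym.hom_ext fun n x => by simp
    rw [this]
    rfl
  f_j _ _ := rfl

/-- Composition. -/
def comp (α : Emb X Y) (β : Emb Y Z) : Emb X Z where
  j n := β.j n ∘ₗ α.j n
  injective n := (β.injective n).comp (α.injective n)
  equivariant n := by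
    rw [← LinearMap.comp_assoc, β.equivariant, LinearMap.comp_assoc, α.equivariant,
      LinearMap.rTensor_comp, LinearMap.comp_assoc]
  map_d n x := by
    rw [← GradedSym.map_map, α.map_d, β.map_d]
    rfl
  f_j n x := by rw [LinearMap.comp_apply, β.f_j, α.f_j]

/-- The induced map of cdgas. -/
def hom (α : Emb X Y) : Cdga.Hom X.toCdga Y.toCdga :=
  FreeCdga.homOfGen (D := X.toFreeCdga) (A := Y.toCdga) (GradedSym.map α.j)
    (fun n x => map_mem_deg α.j (of_mem_deg n x))
    (fun n x => (α.map_d n x).trans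
      ((Y.d_gen n _).symm.trans (congrArg Y.toCdga.d (GradedSym.map_of α.j n x).symm)))
    (fun n => by
      have h : (GradedSym.map α.j).toLinearMap ∘ₗ GradedSym.of n = GradedSym.of n ∘ₗ α.j n :=
        LinearMap.ext fun x => GradedSym.map_of α.j n x
      change (coaction Y.ρ).toLinearMap ∘ₗ
        ((GradedSym.map α.j).toLinearMap ∘ₗ GradedSym.of n) =
        ((GradedSym.map α.j).toLinearMap ∘ₗ GradedSym.of n).rTensor H ∘ₗ X.ρ n
      rw [h, ← LinearMap.comp_assoc, coaction_comp_of, LinearMap.comp_assoc, α.equivariant,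
        LinearMap.rTensor_comp, LinearMap.comp_assoc])

theorem hom_gen (α : Emb X Y) (n : ℤ) (x : X.E n) :
    α.hom.toAlgHom (X.gen n x) = Y.gen n (α.j n x) := GradedSym.map_of α.j n x

theorem hom_injective (α : Emb X Y) : Function.Injective α.hom.toAlgHom :=
  GradedSym.map_injective α.injective

theorem hom_hom (α : Emb X Y) (a : X.toCdga) :
    Y.hom.toAlgHom (α.hom.toAlgHom a) = X.hom.toAlgHom a := by
  rw [← AlgHom.comp_apply]
  congr 1
  apply FreeCdga.algHom_ext
  intro n x
  rw [AlgHom.comp_apply, hom_gen, FreeOver.hom_gen, FreeOver.hom_gen, α.f_j]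

theorem comp_hom (α : Emb X Y) (β : Emb Y Z) (a : X.toCdga) :
    (α.comp β).hom.toAlgHom a = β.hom.toAlgHom (α.hom.toAlgHom a) :=
  (GradedSym.map_map α.j β.j a).symm

end Emb

instance : Category.{v} (FreeOver A) where
  Hom := Emb
  id := Emb.id
  comp := Emb.comp

end FreeOver

end CdgaOver

namespace CdgaOver

open GradedSym CategoryTheory

variable {H : Type u} [CommRing H] [HopfAlgebra ℚ H]

/-! ### Adjoining generators in one degree -/

section Equivariance

variable {V : Type*} [AddCommGroup V] [Module ℚ V] {V' : Type*} [AddCommGroup V'] [Module ℚ V']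
variable {W : Type*} [AddCommGroup W] [Module ℚ W]
variable {ρ : V →ₗ[ℚ] V ⊗[ℚ] H} {ρ' : V' →ₗ[ℚ] V' ⊗[ℚ] H} {ρW : W →ₗ[ℚ] W ⊗[ℚ] H}

theorem equivariant_comp {f : V →ₗ[ℚ] V'} {g : V' →ₗ[ℚ] W}
    (hf : ρ' ∘ₗ f = f.rTensor H ∘ₗ ρ) (hg : ρW ∘ₗ g = g.rTensor H ∘ₗ ρ') :
    ρW ∘ₗ (g ∘ₗ f) = (g ∘ₗ f).rTensor H ∘ₗ ρ := by
  rw [← LinearMap.comp_assoc, hg, LinearMap.comp_assoc, hf, LinearMap.rTensor_comp,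
    LinearMap.comp_assoc]

theorem equivariant_coprod {f : V →ₗ[ℚ] W} {g : V' →ₗ[ℚ] W}
    (hf : ρW ∘ₗ f = f.rTensor H ∘ₗ ρ) (hg : ρW ∘ₗ g = g.rTensor H ∘ₗ ρ') :
    ρW ∘ₗ f.coprod g = (f.coprod g).rTensor H ∘ₗ prodRep ρ ρ' := by
  apply LinearMap.prod_ext
  · rw [LinearMap.comp_assoc, LinearMap.comp_assoc, prodRep_inl, LinearMap.coprod_inl,
      ← LinearMap.comp_assoc ρ, ← LinearMap.rTensor_comp, LinearMap.coprod_inl, hf]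
  · rw [LinearMap.comp_assoc, LinearMap.comp_assoc, prodRep_inr, LinearMap.coprod_inr,
      ← LinearMap.comp_assoc ρ', ← LinearMap.rTensor_comp, LinearMap.coprod_inr, hg]

theorem isSubrep_bot : IsSubrep ρ ⊥ := by
  rw [isSubrep_iff]
  rintro φ x hx
  rw [(Submodule.mem_bot ℚ).1 hx, map_zero]
  exact zero_mem _

end Equivariance

namespace FreeOver

variable {A : Cdga.{u, v} H} (X : FreeOver A)

/-- The representation `X ⊕ A`. -/
abbrev pairRep : (X.toCdga × A) →ₗ[ℚ] (X.toCdga × A) ⊗[ℚ] H :=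
  prodRep X.toCdga.ρ.toLinearMap A.ρ.toLinearMap

/-- The space of pairs `(z, a)` of a cocycle `z` of degree `n + 1` and an element `a` of degree
`n` whose differential is the image of `z`. -/
def pairs (n : ℤ) : Submodule ℚ (X.toCdga × A) where
  carrier := {p | p.1 ∈ X.toCdga.deg (n + 1) ∧ p.2 ∈ A.deg n ∧ X.toCdga.d p.1 = 0 ∧
    A.d p.2 = X.hom.toAlgHom p.1}
  zero_mem' := by simp
  add_mem' := by
    rintro p q ⟨h₁, h₂, h₃, h₄⟩ ⟨h₁', h₂', h₃', h₄'⟩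
    exact ⟨add_mem h₁ h₁', add_mem h₂ h₂', by simp [h₃, h₃'], by simp [h₄, h₄']⟩
  smul_mem' := by
    rintro c p ⟨h₁, h₂, h₃, h₄⟩
    exact ⟨Submodule.smul_mem _ _ h₁, Submodule.smul_mem _ _ h₂, by simp [h₃], by simp [h₄]⟩

variable {n : ℤ} (V : Submodule ℚ (X.toCdga × A))

/-- A space of pairs as a graded space concentrated in degree `n`. -/
def conc (n : ℤ) (V : Submodule ℚ (X.toCdga × A)) (m : ℤ) : Submodule ℚ (X.toCdga × A) :=
  if m = n then V else ⊥

theorem conc_self : X.conc n V n = V := if_pos rfl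

variable {X V} in
theorem isSubrep_conc (hV : IsSubrep X.pairRep V) (m : ℤ) : IsSubrep X.pairRep (X.conc n V m) := by
  unfold conc
  split_ifs
  · exact hV
  · exact isSubrep_bot

variable {X V} in
theorem conc_le (hn : V ≤ X.pairs n) (m : ℤ) : X.conc n V m ≤ X.pairs m := by
  unfold conc
  split_ifs with h
  · rwa [h]
  · exact bot_le

variable {X V}

section Extension

variable (n V) in
/-- The differential of the new generators of the extension of `X` by `V`. -/
def extFst (m : ℤ) : X.conc n V m →ₗ[ℚ] GradedSym X.E :=
  LinearMap.fst ℚ X.toCdga A ∘ₗ (X.conc n V m).subtype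

variable (n V) in
/-- The differential of the generators of the extension of `X` by `V`, with values in `X`. -/
def extD (m : ℤ) : X.E m × X.conc n V m →ₗ[ℚ] GradedSym X.E :=
  (X.d m).coprod (extFst n V m)

theorem extD_apply (m : ℤ) (x : X.E m × X.conc n V m) :
    extD n V m x = X.d m x.1 + extFst n V m x.2 := rfl

variable (X n V) in
/-- The inclusion of the old generators. -/
abbrev extInl (m : ℤ) : X.E m →ₗ[ℚ] X.E m × X.conc n V m := LinearMap.inl ℚ _ _

variable (n) in
/-- The coaction on the generators of the extension of `X` by `V`. -/
abbrev extRep (hV : IsSubrep X.pairRep V) (m : ℤ) :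
    X.E m × X.conc n V m →ₗ[ℚ] (X.E m × X.conc n V m) ⊗[ℚ] H :=
  prodRep (X.ρ m) (restrict X.pairRep (X.conc n V m) (isSubrep_conc hV m))

theorem extD_equivariant (hV : IsSubrep X.pairRep V) (m : ℤ) :
    (coaction X.ρ).toLinearMap ∘ₗ extD n V m = (extD n V m).rTensor H ∘ₗ extRep n hV m :=
  equivariant_coprod (X.d_equivariant m)
    (equivariant_comp (ρW := (coaction X.ρ).toLinearMap)
      (subtype_restrict (isSubrep_conc hV m)) fst_prodRep)

theorem extD_mem (hVn : V ≤ X.pairs n) (m : ℤ) (x : X.E m × X.conc n V m) :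
    extD n V m x ∈ deg X.E (m + 1) :=
  add_mem (X.d_mem m x.1) (conc_le hVn m x.2.2).1

/-- The differentials of all generators, old and new, lie in `X`, so d² = 0 is a computation in `X`:
new generators map to cocycles. -/
theorem der_extD (hVn : V ≤ X.pairs n) (m : ℤ) (x : X.E m × X.conc n V m) :
    der X.d X.d_mem (extD n V m x) = 0 := by
  have h₁ : der X.d X.d_mem (extFst n V m x.2) = 0 :=
    (conc_le hVn m x.2.2).2.2.1
  rw [extD_apply, map_add, X.d_d, h₁, add_zero]

/-- The extension of the free cdga `X` over `G`, as a free cdga, by new generators `V` in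
degree `n`. On the new generators the differential is the first projection. -/
def extCdga (hn : 1 ≤ n) (hV : IsSubrep X.pairRep V) (hVn : V ≤ X.pairs n) : FreeCdga.{u, v} H where
  E m := X.E m × X.conc n V m
  subsingleton m hm := by
    have := X.subsingleton m hm
    have h : X.conc n V m = ⊥ := if_neg (by omega)
    rw [h]
    infer_instance
  ρ m := extRep n hV m
  isRep m := (X.isRep m).prod ((X.toCdga.isRep.prod A.isRep).restrict (isSubrep_conc hV m))
  d m := (GradedSym.map (X.extInl n V)).toLinearMap ∘ₗ extD n V m
  d_mem m x := map_mem_deg (X.extInl n V) (extD_mem hVn m x)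
  d_d m x := by
    -- The inclusion of old generators intertwines the two derivations, which moves d² back into
    -- `X`.
    have h := map_der (F := fun m => X.E m × X.conc n V m) (X.extInl n V) (hD := X.d_mem)
      (hD' := fun m x => map_mem_deg (X.extInl n V) (extD_mem hVn m x))
      (D' := fun m => (GradedSym.map (X.extInl n V)).toLinearMap ∘ₗ extD n V m)
      (fun m x => by simp [extD]) (extD n V m x)
    rw [der_extD hVn, map_zero] at h
    exact h.symm
  d_equivariant m := equivariant_comp (extD_equivariant hV m)
    (coaction_map (X.extInl n V) (fun m => prodRep_inl))

variable (hn : 1 ≤ n) (hV : IsSubrep X.pairRep V) (hVn : V ≤ X.pairs n)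

/-- On the image of `X` the extended map is `X.hom`, so for a new generator (z, a) the claim is the
condition da = s(z) defining `pairs`. -/
theorem ext_f_d (f : ∀ m, (extCdga hn hV hVn).E m →ₗ[ℚ] A)
    (hf : f = fun m => (X.f m).coprod (LinearMap.snd ℚ X.toCdga A ∘ₗ (X.conc n V m).subtype))
    (f_mem : ∀ m x, f m x ∈ A.deg m) (m : ℤ) (x : (extCdga hn hV hVn).E m) :
    FreeCdga.liftAlgHom f f_mem ((extCdga hn hV hVn).d m x) = A.d (f m x) := by
  have h : ((FreeCdga.liftAlgHom f f_mem : GradedSym (extCdga hn hV hVn).E →ₐ[ℚ] A).comp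
      (GradedSym.map (X.extInl n V))) = X.hom.toAlgHom := by
    apply GradedSym.hom_ext (E := X.E)
    intro m x
    refine (congrArg (FreeCdga.liftAlgHom f f_mem) (GradedSym.map_of (X.extInl n V) m x)).trans ?_
    refine (FreeCdga.liftAlgHom_gen (D := extCdga hn hV hVn) f f_mem _ _).trans ?_
    refine Eq.trans ?_ (X.hom_gen m x).symm
    rw [hf]
    change X.f m x + 0 = X.f m x
    rw [add_zero]
  have h₁ := DFunLike.congr_fun h (extD n V m x)
  have h₂ : X.hom.toAlgHom (extD n V m x) = X.hom.toAlgHom (X.d m x.1) +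
    X.hom.toAlgHom (x.2 : X.toCdga × A).1 := map_add X.hom.toAlgHom _ _
  have h₃ : X.hom.toAlgHom (X.d m x.1) = A.d (X.f m x.1) := X.f_d m x.1
  refine (h₁.trans h₂).trans ((congrArg₂ (· + ·) h₃ (conc_le hVn m x.2.2).2.2.2.symm).trans ?_)
  rw [← map_add, hf]
  rfl

/-- The extension of the free cdga `X` over `A` by new generators `V` in degree `n`; on them the
differential is the first projection and the map to `A` is the second projection. -/
def ext : FreeOver A where
  toFreeCdga := extCdga hn hV hVn
  f m := (X.f m).coprod (LinearMap.snd ℚ X.toCdga A ∘ₗ (X.conc n V m).subtype)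
  f_mem m x := add_mem (X.f_mem m x.1) (conc_le hVn m x.2.2).2.1
  f_d m x := ext_f_d hn hV hVn _ rfl _ m x
  f_equivariant m := equivariant_coprod (X.f_equivariant m)
    (equivariant_comp (subtype_restrict (isSubrep_conc hV m)) snd_prodRep)

/-- The inclusion of `X` into its extension. -/
def toExt : X ⟶ ext hn hV hVn where
  j := X.extInl n V
  injective m := LinearMap.inl_injective
  equivariant m := prodRep_inl
  map_d m x := by
    change _ = GradedSym.map (X.extInl n V) (extD n V m (x, 0))
    rw [extD_apply, map_zero, add_zero]
    rfl
  f_j m x := by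
    change X.f m x + 0 = X.f m x
    rw [add_zero]

/-- The new generators. -/
def newGen : V →ₗ[ℚ] (ext hn hV hVn).toCdga :=
  (ext hn hV hVn).gen n ∘ₗ LinearMap.inr ℚ (X.E n) (X.conc n V n) ∘ₗ
    Submodule.inclusion (X.conc_self V).ge

theorem newGen_mem (x : V) : newGen hn hV hVn x ∈ (ext hn hV hVn).toCdga.deg n :=
  (ext hn hV hVn).gen_mem n _

theorem d_newGen (x : V) : (ext hn hV hVn).toCdga.d (newGen hn hV hVn x) =
    (toExt hn hV hVn).hom.toAlgHom (x : X.toCdga × A).1 := by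
  refine ((ext hn hV hVn).d_gen n _).trans ?_
  change GradedSym.map (X.extInl n V) (extD n V n (0, _)) = GradedSym.map (X.extInl n V) _
  rw [extD_apply, map_zero, zero_add]
  rfl

theorem hom_newGen (x : V) : (ext hn hV hVn).hom.toAlgHom (newGen hn hV hVn x) =
    (x : X.toCdga × A).2 := by
  refine ((ext hn hV hVn).hom_gen n _).trans ?_
  change X.f n 0 + (x : X.toCdga × A).2 = _
  rw [map_zero, zero_add]

theorem gen_ext (m : ℤ) (x : (ext hn hV hVn).E m) :
    ∃ (e : X.E m) (y : V), (m ≠ n → y = 0) ∧ (ext hn hV hVn).gen m x =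
      (toExt hn hV hVn).hom.toAlgHom (X.gen m e) + newGen hn hV hVn y := by
  obtain ⟨e, y, hy⟩ := x
  have h₁ : (toExt hn hV hVn).hom.toAlgHom (X.gen m e) = (ext hn hV hVn).gen m (e, 0) :=
    (toExt hn hV hVn).hom_gen m e
  by_cases hm : m = n
  · subst hm
    have hy' : y ∈ V := X.conc_self V ▸ hy
    refine ⟨e, ⟨y, hy'⟩, by simp, ?_⟩
    have h₂ : ((e, ⟨y, hy⟩) : X.E m × X.conc m V m) = (e, 0) + (0, ⟨y, hy⟩) :=
      Prod.ext (add_zero _).symm (zero_add _).symm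
    refine (congrArg ((ext hn hV hVn).gen m) h₂).trans ((map_add _ _ _).trans ?_)
    rw [h₁]
    rfl
  · have h : X.conc n V m = ⊥ := if_neg hm
    obtain rfl : y = 0 := by rw [h] at hy; exact hy
    refine ⟨e, 0, fun _ => rfl, ?_⟩
    rw [h₁, map_zero, add_zero]
    rfl

end Extension

end FreeOver

end CdgaOver

namespace CdgaOver

/-! ### Elements of low degree in an extension -/

open GradedSym CategoryTheory

theorem GradedSym.mem_deg_of_map_mem {E : ℤ → Type v} [∀ n, AddCommGroup (E n)]
    [∀ n, Module ℚ (E n)] {F : ℤ → Type v} [∀ n, AddCommGroup (F n)] [∀ n, Module ℚ (F n)]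
    {f : ∀ n, E n →ₗ[ℚ] F n} (hf : ∀ n, Function.Injective (f n)) {n : ℤ} {a : GradedSym E}
    (ha : map f a ∈ deg F n) : a ∈ deg E n := by
  choose g hg using fun n => LinearMap.exists_leftInverse_of_injective (f n)
    (LinearMap.ker_eq_bot.2 (hf n))
  have h : (map g).comp (map f) = AlgHom.id ℚ _ := by
    apply hom_ext
    intro n x
    simpa using congrArg (of n) (LinearMap.congr_fun (hg n) x)
  have h' := DFunLike.congr_fun h a
  simp only [AlgHom.comp_apply, AlgHom.id_apply] at h'
  rw [← h']
  exact map_mem_deg g ha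

variable {H : Type u} [CommRing H] [HopfAlgebra ℚ H]

namespace FreeOver

variable {A : Cdga.{u, v} H} {X Y : FreeOver A} {n : ℤ} {V : Submodule ℚ (X.toCdga × A)}

theorem Emb.mem_deg (α : Emb X Y) {m : ℤ} {a : X.toCdga}
    (ha : α.hom.toAlgHom a ∈ Y.toCdga.deg m) : a ∈ X.toCdga.deg m :=
  GradedSym.mem_deg_of_map_mem α.injective ha

section Extension

variable (hn : 1 ≤ n) (hV : IsSubrep X.pairRep V) (hVn : V ≤ X.pairs n)

/-- In degree ≤ n a new generator, itself of degree n, can only be multiplied by elements of degree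
0, which are scalars. -/
theorem mem_deg_ext {m : ℤ} {a : (ext hn hV hVn).toCdga} (ha : a ∈ (ext hn hV hVn).toCdga.deg m) :
    (m < n → ∃ b, (toExt hn hV hVn).hom.toAlgHom b = a) ∧
      (m = n → ∃ b v, (toExt hn hV hVn).hom.toAlgHom b + newGen hn hV hVn v = a) := by
  let R := LinearMap.range (toExt hn hV hVn).hom.toAlgHom.toLinearMap
  let P := R ⊔ LinearMap.range (newGen hn hV hVn)
  -- The conditions in degrees ≤ 0 are included because closure under products depends on them.
  let N : ℤ → Submodule ℚ (ext hn hV hVn).toCdga := fun m =>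
    (⨅ _ : m < 0, ⊥) ⊓ (⨅ _ : m = 0, Submodule.span ℚ {1}) ⊓ (⨅ _ : m < n, R) ⊓ ⨅ _ : m = n, P
  have hN : ∀ {m a}, a ∈ N m ↔ (((m < 0 → a = 0) ∧ (m = 0 → a ∈ Submodule.span ℚ {1})) ∧
      (m < n → a ∈ R)) ∧ (m = n → a ∈ P) := by simp [N]
  have hRmul : ∀ a ∈ R, ∀ b ∈ R, a * b ∈ R := by
    rintro _ ⟨a, rfl⟩ _ ⟨b, rfl⟩
    exact ⟨a * b, map_mul (toExt hn hV hVn).hom.toAlgHom a b⟩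
  have h1 : (1 : (ext hn hV hVn).toCdga) ∈ R := ⟨1, map_one (toExt hn hV hVn).hom.toAlgHom⟩
  have key : a ∈ N m := by
    refine (ext hn hV hVn).deg_le N ?_ ?_ ?_ m ha
    · rw [hN]
      exact ⟨⟨⟨fun h => absurd h (by simp), fun _ => Submodule.mem_span_singleton_self _⟩,
        fun _ => h1⟩, fun _ => Submodule.mem_sup_left h1⟩
    · intro i x
      rw [hN]
      obtain ⟨e, y, hy, h⟩ := gen_ext hn hV hVn i x
      have hg := (ext hn hV hVn).gen_mem i x
      refine ⟨⟨⟨fun hi => FreeCdga.eq_zero_of_mem_deg_neg hi hg, ?_⟩, fun hi => ?_⟩, fun _ => ?_⟩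
      · rintro rfl
        exact FreeCdga.mem_span_one_of_mem_deg_zero hg
      · rw [h, hy (by omega), map_zero, add_zero]
        exact ⟨_, rfl⟩
      · rw [h]
        exact add_mem (Submodule.mem_sup_left ⟨_, rfl⟩) (Submodule.mem_sup_right ⟨_, rfl⟩)
    · intro i j a b ha hb
      rw [hN] at *
      obtain ⟨⟨⟨ha₁, ha₂⟩, ha₃⟩, ha₄⟩ := ha
      obtain ⟨⟨⟨hb₁, hb₂⟩, hb₃⟩, hb₄⟩ := hb
      by_cases hi : i < 0
      · rw [ha₁ hi, zero_mul]; simp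
      by_cases hj : j < 0
      · rw [hb₁ hj, mul_zero]; simp
      refine ⟨⟨⟨fun h => by omega, fun h => ?_⟩, fun h => ?_⟩, fun h => ?_⟩
      · obtain ⟨r, rfl⟩ := Submodule.mem_span_singleton.1 (ha₂ (by omega))
        rw [smul_mul_assoc, one_mul]
        exact Submodule.smul_mem _ _ (hb₂ (by omega))
      · exact hRmul a (ha₃ (by omega)) b (hb₃ (by omega))
      · by_cases hi0 : i = 0
        · obtain ⟨r, rfl⟩ := Submodule.mem_span_singleton.1 (ha₂ hi0)
          rw [smul_mul_assoc, one_mul]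
          exact Submodule.smul_mem _ _ (hb₄ (by omega))
        by_cases hj0 : j = 0
        · obtain ⟨r, rfl⟩ := Submodule.mem_span_singleton.1 (hb₂ hj0)
          rw [mul_smul_comm, mul_one]
          exact Submodule.smul_mem _ _ (ha₄ (by omega))
        -- Both factors have degree strictly between 0 and n, so both come from `X`.
        · exact Submodule.mem_sup_left (hRmul a (ha₃ (by omega)) b (hb₃ (by omega)))
  rw [hN] at key
  refine ⟨fun h => key.1.2 h, fun h => ?_⟩
  obtain ⟨_, ⟨b, rfl⟩, _, ⟨v, rfl⟩, h⟩ := Submodule.mem_sup.1 (key.2 h)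
  exact ⟨b, v, h⟩

theorem exists_of_mem_deg_ext {m : ℤ} (hm : m < n) {a : (ext hn hV hVn).toCdga}
    (ha : a ∈ (ext hn hV hVn).toCdga.deg m) :
    ∃ b ∈ X.toCdga.deg m, (toExt hn hV hVn).hom.toAlgHom b = a := by
  obtain ⟨b, rfl⟩ := (mem_deg_ext hn hV hVn ha).1 hm
  exact ⟨b, Emb.mem_deg _ ha, rfl⟩

theorem exists_of_mem_deg_ext_self {a : (ext hn hV hVn).toCdga}
    (ha : a ∈ (ext hn hV hVn).toCdga.deg n) :
    ∃ b ∈ X.toCdga.deg n, ∃ v, (toExt hn hV hVn).hom.toAlgHom b + newGen hn hV hVn v = a := by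
  obtain ⟨b, v, rfl⟩ := (mem_deg_ext hn hV hVn ha).2 rfl
  refine ⟨b, Emb.mem_deg (toExt hn hV hVn) ?_, v, rfl⟩
  have := sub_mem ha (newGen_mem hn hV hVn v)
  rwa [add_sub_cancel_right] at this

theorem adjoin_ext : Algebra.adjoin ℚ (Set.range (toExt hn hV hVn).hom.toAlgHom ∪
    Set.range (newGen hn hV hVn)) = ⊤ := by
  rw [eq_top_iff, ← (ext hn hV hVn).adjoin_gen, Algebra.adjoin_le_iff]
  rintro _ ⟨m, x, rfl⟩
  obtain ⟨e, y, -, h⟩ := gen_ext hn hV hVn m x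
  rw [h]
  exact add_mem (Algebra.subset_adjoin (Or.inl ⟨_, rfl⟩))
    (Algebra.subset_adjoin (Or.inr ⟨_, rfl⟩))

/-- `X` has no generators of Adams degree `≤ 0`. -/
def AdamsPos (w : CentralCocharacter H) (X : FreeOver A) : Prop :=
  ∀ m, ∀ r ≤ 0, adamsPart w (X.ρ m) r = ⊥

/-- A new generator is a pair of elements of degrees n + 1 and n, both nonzero; in Adams degree ≤ 0
connectedness of `X` and `A` kills both. -/
theorem eq_zero_of_mem_adamsPart_extRep (hn : 1 ≤ n) (hVn : V ≤ X.pairs n)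
    {w : CentralCocharacter H} (hA : A.AdamsConnected w) (hX : AdamsPos w X) {m r : ℤ}
    (hr : r ≤ 0) {p : X.E m × X.conc n V m} (hp : p ∈ adamsPart w (extRep n hV m) r) : p = 0 := by
  have hX' := X.adamsConnected w hX
  have h₁ : p.1 ∈ adamsPart w (X.ρ m) r :=
    map_mem_adamsPart w (f := LinearMap.fst ℚ _ _) fst_prodRep hp
  have h₂ : p.2 ∈ adamsPart w (restrict X.pairRep (X.conc n V m) (isSubrep_conc hV m)) r :=
    map_mem_adamsPart w (f := LinearMap.snd ℚ _ _) snd_prodRep hp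
  have h₃ : (p.2 : X.toCdga × A) ∈ adamsPart w X.pairRep r :=
    map_mem_adamsPart w (subtype_restrict (isSubrep_conc hV m)) h₂
  have h₄ : (p.2 : X.toCdga × A).1 ∈ X.toCdga.adams w r :=
    map_mem_adamsPart w (f := LinearMap.fst ℚ _ _) fst_prodRep h₃
  have h₅ : (p.2 : X.toCdga × A).2 ∈ A.adams w r :=
    map_mem_adamsPart w (f := LinearMap.snd ℚ _ _) snd_prodRep h₃
  obtain ⟨h₆, h₇, -⟩ := conc_le hVn m p.2.2
  rw [hX m r hr, Submodule.mem_bot] at h₁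
  refine Prod.ext h₁ (Subtype.ext ?_)
  by_cases hm : m = n
  · exact Prod.ext (hX'.eq_zero hr (by omega) h₄ h₆) (hA.eq_zero hr (by omega) h₅ h₇)
  · have h : X.conc n V m = ⊥ := if_neg hm
    exact (Submodule.mem_bot ℚ).1 (h.le p.2.2)

theorem adamsPos_ext {w : CentralCocharacter H} (hA : A.AdamsConnected w) (hX : AdamsPos w X) :
    AdamsPos w (ext hn hV hVn) := fun _ _ hr =>
  eq_bot_iff.2 fun _ hp => eq_zero_of_mem_adamsPart_extRep hV hn hVn hA hX hr hp

end Extension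

end FreeOver

end CdgaOver

namespace CdgaOver

variable {H : Type u} [CommRing H] [HopfAlgebra ℚ H]

namespace Cdga

variable {A M : Cdga.{u, v} H}

/-! ### Cohomology in terms of elements -/

theorem mk_eq_zero_iff {n : ℤ} (z : A.cocycles n) :
    (Submodule.Quotient.mk z : A.Cohomology n) = 0 ↔ (z : A) ∈ A.coboundaries n :=
  Submodule.Quotient.mk_eq_zero _

theorem Hom.mapCohomology_mk (s : Hom M A) {n : ℤ} (z : M.cocycles n) :
    s.mapCohomology n (Submodule.Quotient.mk z) =
      Submodule.Quotient.mk ⟨s.toAlgHom z, s.map_cocycles n z z.2⟩ := rfl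

theorem Hom.mapCohomology_injective (s : Hom M A) (n : ℤ)
    (h : ∀ z ∈ M.cocycles n, s.toAlgHom z ∈ A.coboundaries n → z ∈ M.coboundaries n) :
    Function.Injective (s.mapCohomology n) := by
  rw [injective_iff_map_eq_zero]
  intro x hx
  obtain ⟨z, rfl⟩ := Submodule.Quotient.mk_surjective _ x
  rw [s.mapCohomology_mk, mk_eq_zero_iff] at hx
  exact (mk_eq_zero_iff z).2 (h z z.2 hx)

theorem Hom.mapCohomology_surjective (s : Hom M A) (n : ℤ)
    (h : ∀ a ∈ A.cocycles n, ∃ z ∈ M.cocycles n, a - s.toAlgHom z ∈ A.coboundaries n) :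
    Function.Surjective (s.mapCohomology n) := by
  intro x
  obtain ⟨⟨a, ha⟩, rfl⟩ := Submodule.Quotient.mk_surjective _ x
  obtain ⟨z, hz, hza⟩ := h a ha
  refine ⟨Submodule.Quotient.mk ⟨z, hz⟩, ?_⟩
  rw [s.mapCohomology_mk, eq_comm, ← sub_eq_zero, ← Submodule.Quotient.mk_sub, mk_eq_zero_iff]
  exact hza

theorem CohomologicallyConnected.mem_coboundaries (h : A.CohomologicallyConnected) {n : ℤ}
    (hn : n < 0) {a : A} (ha : a ∈ A.cocycles n) : a ∈ A.coboundaries n := by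
  have := h.1 n hn
  rw [← mk_eq_zero_iff ⟨a, ha⟩]
  exact Subsingleton.elim _ _

theorem CohomologicallyConnected.exists_sub_mem (h : A.CohomologicallyConnected) {a : A}
    (ha : a ∈ A.cocycles 0) : ∃ q : ℚ, a - q • 1 ∈ A.coboundaries 0 := by
  obtain ⟨q, hq⟩ := h.2.2 (Submodule.Quotient.mk ⟨a, ha⟩)
  refine ⟨q, ?_⟩
  have h1 : (1 : A) ∈ A.cocycles 0 := ⟨A.one_mem_deg, A.d_one⟩
  rw [unitCohomology, LinearMap.toSpanSingleton_apply, eq_comm, ← sub_eq_zero,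
    ← Submodule.Quotient.mk_smul, ← Submodule.Quotient.mk_sub, mk_eq_zero_iff] at hq
  exact hq

theorem CohomologicallyConnected.eq_zero (h : A.CohomologicallyConnected) {q : ℚ}
    (hq : q • (1 : A) ∈ A.coboundaries 0) : q = 0 := by
  apply h.2.1
  rw [map_zero, unitCohomology, LinearMap.toSpanSingleton_apply, ← Submodule.Quotient.mk_smul,
    mk_eq_zero_iff]
  exact hq

/-! ### The filtrations by degree of generators -/

theorem sub_mono {m n : ℤ} (h : m ≤ n) : A.sub m ≤ A.sub n :=
  Algebra.adjoin_mono fun _ ⟨i, hi, ha⟩ => ⟨i, hi.trans h, ha⟩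

theorem mem_sub {m n : ℤ} (h : m ≤ n) {a : A} (ha : a ∈ A.deg m) : a ∈ A.sub n :=
  Algebra.subset_adjoin ⟨m, h, ha⟩

theorem subSucc_le_succ (n q : ℕ) : A.subSucc n q ≤ A.subSucc n (q + 1) := by
  induction q with
  | zero => exact fun x hx => Algebra.subset_adjoin (Or.inl hx)
  | succ q ih =>
    exact Algebra.adjoin_mono (Set.union_subset_union_right _ fun x hx => ⟨hx.1, hx.2.1, ih hx.2.2⟩)

theorem subSucc_mono (n : ℕ) : Monotone (A.subSucc n) := monotone_nat_of_le_succ (subSucc_le_succ n)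

theorem subSucc_le (n q : ℕ) : A.subSucc n q ≤ A.sub (n + 1) := by
  cases q with
  | zero => exact sub_mono (by omega)
  | succ q =>
    rw [subSucc, Algebra.adjoin_le_iff]
    exact Set.union_subset (sub_mono (A := A) (by omega)) fun x hx => hx.1

variable (A) in
/-- Condition (ii) of generalized nilpotence, for homogeneous elements. -/
def Nilpotent : Prop := ∀ n : ℕ, ∀ a ∈ A.deg (n + 1), ∃ q, a ∈ A.subSucc n q

/-- Degrees ≤ n belong to stage 0 and degree n + 1 is the hypothesis; the stages increase, so sums
and products stay in a common stage. -/
theorem Nilpotent.exists_mem_subSucc (h : A.Nilpotent) (n : ℕ) {a : A} (ha : a ∈ A.sub (n + 1)) :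
    ∃ q, a ∈ A.subSucc n q := by
  induction ha using Algebra.adjoin_induction with
  | mem x hx =>
    obtain ⟨m, hm, hx⟩ := hx
    rcases hm.lt_or_eq with hm | rfl
    · exact ⟨0, mem_sub (by omega) hx⟩
    · exact h n x hx
  | algebraMap r => exact ⟨0, Subalgebra.algebraMap_mem _ r⟩
  | add x y _ _ hx hy =>
    obtain ⟨p, hp⟩ := hx
    obtain ⟨q, hq⟩ := hy
    exact ⟨max p q, add_mem (subSucc_mono n (le_max_left p q) hp)
      (subSucc_mono n (le_max_right p q) hq)⟩
  | mul x y _ _ hx hy =>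
    obtain ⟨p, hp⟩ := hx
    obtain ⟨q, hq⟩ := hy
    exact ⟨max p q, mul_mem (subSucc_mono n (le_max_left p q) hp)
      (subSucc_mono n (le_max_right p q) hq)⟩

theorem Nilpotent.sub_eq (h : A.Nilpotent) (n : ℕ) :
    (A.sub (n + 1) : Set A) = ⋃ q : ℕ, (A.subSucc n q : Set A) := by
  ext a
  rw [Set.mem_iUnion]
  exact ⟨fun ha => h.exists_mem_subSucc n ha, fun ⟨q, hq⟩ => subSucc_le n q hq⟩

theorem Hom.map_sub (f : Hom M A) (n : ℤ) {a : M} (ha : a ∈ M.sub n) : f.toAlgHom a ∈ A.sub n := by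
  change a ∈ (A.sub n).comap f.toAlgHom
  refine Algebra.adjoin_le ?_ ha
  rintro x ⟨m, hm, hx⟩
  exact mem_sub hm (f.map_deg m x hx)

theorem Hom.map_subSucc (f : Hom M A) (n q : ℕ) {a : M} (ha : a ∈ M.subSucc n q) :
    f.toAlgHom a ∈ A.subSucc n q := by
  induction q generalizing a with
  | zero => exact f.map_sub n ha
  | succ q ih =>
    change a ∈ (A.subSucc n (q + 1)).comap f.toAlgHom
    refine Algebra.adjoin_le ?_ ha
    rintro x (hx | ⟨h₁, h₂, h₃⟩)
    · exact Algebra.subset_adjoin (Or.inl (f.map_sub n hx))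
    · refine Algebra.subset_adjoin (Or.inr ⟨f.map_sub _ h₁, f.map_deg _ x h₂, ?_⟩)
      have h₄ := ih h₃
      rwa [f.map_d] at h₄

end Cdga

open GradedSym CategoryTheory

namespace FreeOver

variable {A : Cdga.{u, v} H}

/-- Injectivity of the structure map on `H^m`. -/
def InjH (X : FreeOver A) (m : ℤ) : Prop :=
  ∀ z ∈ X.toCdga.cocycles m, X.hom.toAlgHom z ∈ A.coboundaries m → z ∈ X.toCdga.coboundaries m

/-- Surjectivity of the structure map on `H^m`. -/
def SurjH (X : FreeOver A) (m : ℤ) : Prop :=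
  ∀ a ∈ A.cocycles m, ∃ z ∈ X.toCdga.cocycles m, a - X.hom.toAlgHom z ∈ A.coboundaries m

/-- In degrees ≤ 0 a free cdga is ℚ, so this and `surjH_of_nonpos` amount to cohomological
connectedness of `A`. -/
theorem injH_of_nonpos (hA : A.CohomologicallyConnected) (X : FreeOver A) {m : ℤ} (hm : m ≤ 0) :
    InjH X m := by
  intro z hz hs
  suffices z = 0 from this ▸ zero_mem _
  rcases hm.lt_or_eq with hm | rfl
  · exact FreeCdga.eq_zero_of_mem_deg_neg hm hz.1
  · obtain ⟨c, rfl⟩ := Submodule.mem_span_singleton.1 (FreeCdga.mem_span_one_of_mem_deg_zero hz.1)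
    rw [map_smul, map_one] at hs
    rw [hA.eq_zero hs, zero_smul]

theorem surjH_of_nonpos (hA : A.CohomologicallyConnected) (X : FreeOver A) {m : ℤ} (hm : m ≤ 0) :
    SurjH X m := by
  intro a ha
  rcases hm.lt_or_eq with hm | rfl
  · exact ⟨0, zero_mem _, by rw [map_zero, sub_zero]; exact hA.mem_coboundaries hm ha⟩
  · obtain ⟨q, hq⟩ := hA.exists_sub_mem ha
    refine ⟨q • 1, Submodule.smul_mem _ _ ⟨X.toCdga.one_mem_deg, X.toCdga.d_one⟩, ?_⟩
    rwa [map_smul, map_one]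

section

variable {X Y : FreeOver A} (α : Emb X Y) {m : ℤ}

theorem Emb.mem_cocycles {z : X.toCdga} (h : α.hom.toAlgHom z ∈ Y.toCdga.cocycles m) :
    z ∈ X.toCdga.cocycles m := by
  refine ⟨α.mem_deg h.1, ?_⟩
  have h₂ : Y.toCdga.d (α.hom.toAlgHom z) = 0 := h.2
  rw [← α.hom.map_d] at h₂
  exact α.hom_injective (h₂.trans (map_zero _).symm)

theorem Emb.map_coboundaries {z : X.toCdga} (h : z ∈ X.toCdga.coboundaries m) :
    α.hom.toAlgHom z ∈ Y.toCdga.coboundaries m := by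
  obtain ⟨b, hb, rfl⟩ := h
  exact ⟨α.hom.toAlgHom b, α.hom.map_deg _ b hb, (α.hom.map_d b).symm⟩

theorem SurjH.of_emb (h : SurjH X m) (α : Emb X Y) : SurjH Y m := by
  intro a ha
  obtain ⟨z, hz, h⟩ := h a ha
  exact ⟨α.hom.toAlgHom z, α.hom.map_cocycles m z hz, by rwa [α.hom_hom]⟩

/-- An element coming from `X` that is a cocycle with exact image in `A` is exact. -/
theorem InjH.of_emb (h : InjH X m) {z : X.toCdga} (hz : α.hom.toAlgHom z ∈ Y.toCdga.cocycles m)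
    (hs : Y.hom.toAlgHom (α.hom.toAlgHom z) ∈ A.coboundaries m) :
    α.hom.toAlgHom z ∈ Y.toCdga.coboundaries m := by
  rw [α.hom_hom] at hs
  exact α.map_coboundaries (h z (α.mem_cocycles hz) hs)

end

/-! ### Adding generators in degree `n` -/

/-- The pairs that are boundaries in the mapping cone of `X → A`. -/
def boundaryPairs (X : FreeOver A) (n : ℤ) : Submodule ℚ (X.toCdga × A) where
  carrier := {p | ∃ b ∈ X.toCdga.deg n, ∃ a ∈ A.deg (n - 1),
    p = (X.toCdga.d b, X.hom.toAlgHom b + A.d a)}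
  zero_mem' := ⟨0, zero_mem _, 0, zero_mem _, by simp; rfl⟩
  add_mem' := by
    rintro _ _ ⟨b, hb, a, ha, rfl⟩ ⟨b', hb', a', ha', rfl⟩
    refine ⟨b + b', add_mem hb hb', a + a', add_mem ha ha', ?_⟩
    simp only [map_add, Prod.mk_add_mk]
    congr 1
    abel
  smul_mem' := by
    rintro c _ ⟨b, hb, a, ha, rfl⟩
    exact ⟨c • b, Submodule.smul_mem _ _ hb, c • a, Submodule.smul_mem _ _ ha, by simp⟩

theorem boundaryPairs_le (X : FreeOver A) (n : ℤ) : X.boundaryPairs n ≤ X.pairs n := by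
  rintro _ ⟨b, hb, a, ha, rfl⟩
  refine ⟨X.toCdga.d_mem n b hb, add_mem (X.hom.map_deg n b hb) ?_, X.toCdga.d_d b, ?_⟩
  · have := A.d_mem _ a ha
    rwa [sub_add_cancel] at this
  · rw [map_add, A.d_d, add_zero, X.hom.map_d]

theorem isSubrep_pairs (X : FreeOver A) (n : ℤ) : IsSubrep X.pairRep (X.pairs n) := by
  rw [isSubrep_iff]
  rintro φ p ⟨h₁, h₂, h₃, h₄⟩
  rw [op_prodRep]
  refine ⟨isSubrep_iff.1 (X.toCdga.deg_subrep _) φ _ h₁, isSubrep_iff.1 (A.deg_subrep _) φ _ h₂,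
    ?_, ?_⟩
  · rw [← op_map X.toCdga.d_equivariant, h₃, map_zero]
  · rw [← op_map A.d_equivariant, h₄]
    exact op_map X.hom.equivariant φ p.1

theorem isSubrep_boundaryPairs (X : FreeOver A) (n : ℤ) :
    IsSubrep X.pairRep (X.boundaryPairs n) := by
  rw [isSubrep_iff]
  rintro φ _ ⟨b, hb, a, ha, rfl⟩
  refine ⟨op _ φ b, isSubrep_iff.1 (X.toCdga.deg_subrep _) φ _ hb, op _ φ a,
    isSubrep_iff.1 (A.deg_subrep _) φ _ ha, ?_⟩
  rw [op_prodRep]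
  refine Prod.ext (op_map X.toCdga.d_equivariant φ b) ?_
  rw [map_add]
  exact congrArg₂ (· + ·) (op_map X.hom.equivariant φ b) (op_map A.d_equivariant φ a)

/-- The inductive hypothesis in the construction of the generators in degree `n`. -/
structure Pre (n : ℕ) (X : FreeOver A) : Prop where
  surj : ∀ m < (n : ℤ), SurjH X m
  inj : ∀ m ≤ (n : ℤ), InjH X m
  generated : X.toCdga.sub n = ⊤
  nilpotent : X.toCdga.Nilpotent
  adams : ∀ w, A.AdamsConnected w → AdamsPos w X

variable {n : ℕ} {X : FreeOver A} {V : Submodule ℚ (X.toCdga × A)} (hn : 1 ≤ (n : ℤ))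
  (hV : IsSubrep X.pairRep V) (hVn : V ≤ X.pairs n)

/-- If b + v is a cocycle with image da', then v is the boundary pair of (-b, a'), hence v = 0 by
`hB`, and the claim reduces to `X`. -/
theorem injH_ext (hX : InjH X n) (hB : ∀ x ∈ V, x ∈ X.boundaryPairs n → x = 0) :
    InjH (ext hn hV hVn) n := by
  rintro z hz ⟨a', ha', hs⟩
  obtain ⟨b, hb, v, rfl⟩ := exists_of_mem_deg_ext_self hn hV hVn hz.1
  have h₁ : (ext hn hV hVn).toCdga.d ((toExt hn hV hVn).hom.toAlgHom b + newGen hn hV hVn v) = 0 :=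
    hz.2
  rw [map_add, d_newGen, ← (toExt hn hV hVn).hom.map_d, ← map_add] at h₁
  have h₂ : X.toCdga.d b + (v : X.toCdga × A).1 = 0 :=
    (toExt hn hV hVn).hom_injective (h₁.trans (map_zero _).symm)
  have h₃ : A.d a' = X.hom.toAlgHom b + (v : X.toCdga × A).2 := by
    rw [hs, map_add, (toExt hn hV hVn).hom_hom, hom_newGen]
  have h₄ : v = 0 := by
    refine Subtype.ext (hB v v.2 ⟨-b, neg_mem hb, a', ha', Prod.ext ?_ ?_⟩)
    · rw [map_neg]
      exact eq_neg_of_add_eq_zero_right h₂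
    · change (v : X.toCdga × A).2 = X.hom.toAlgHom (-b) + A.d a'
      rw [map_neg, h₃, neg_add_cancel_left]
  rw [h₄, map_zero, add_zero] at hz ⊢
  refine hX.of_emb (toExt hn hV hVn) hz ⟨a', ha', ?_⟩
  rw [(toExt hn hV hVn).hom_hom, h₃, h₄]
  exact add_zero _

/-- Every relative cocycle becomes a boundary in the extension. Pairs (0, a) give surjectivity on
H^n; pairs (z, a) kill the kernel on H^{n+1}. -/
theorem exists_pair (hC : ∀ z ∈ X.pairs n, ∃ x ∈ V, ∃ b ∈ X.boundaryPairs n, z = x + b)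
    {p : X.toCdga × A} (hp : p ∈ X.pairs n) : ∃ y ∈ (ext hn hV hVn).toCdga.deg n,
      (ext hn hV hVn).toCdga.d y = (toExt hn hV hVn).hom.toAlgHom p.1 ∧
      p.2 - (ext hn hV hVn).hom.toAlgHom y ∈ A.coboundaries n := by
  obtain ⟨x, hx, _, ⟨b, hb, a, ha, rfl⟩, rfl⟩ := hC p hp
  refine ⟨newGen hn hV hVn ⟨x, hx⟩ + (toExt hn hV hVn).hom.toAlgHom b,
    add_mem (newGen_mem hn hV hVn _) ((toExt hn hV hVn).hom.map_deg _ b hb), ?_, ?_⟩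
  · rw [map_add, d_newGen, ← (toExt hn hV hVn).hom.map_d, ← map_add]
    rfl
  · refine ⟨a, ha, ?_⟩
    rw [map_add, hom_newGen, (toExt hn hV hVn).hom_hom]
    change A.d a = x.2 + (X.hom.toAlgHom b + A.d a) - (x.2 + X.hom.toAlgHom b)
    abel

theorem sub_ext_eq_top (hX : X.toCdga.sub n = ⊤) : (ext hn hV hVn).toCdga.sub n = ⊤ := by
  rw [eq_top_iff, ← adjoin_ext hn hV hVn, Algebra.adjoin_le_iff]
  rintro _ (⟨x, rfl⟩ | ⟨v, rfl⟩)
  · exact (toExt hn hV hVn).hom.map_sub n (hX ▸ Algebra.mem_top)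
  · exact Cdga.mem_sub le_rfl (newGen_mem hn hV hVn v)

/-- Only degree n is affected: if dv lies in stage r, then v lies in stage r + 1. -/
theorem nilpotent_ext (hX : X.toCdga.Nilpotent) (hX' : X.toCdga.sub n = ⊤) :
    (ext hn hV hVn).toCdga.Nilpotent := by
  intro k a ha
  rcases lt_trichotomy ((k : ℤ) + 1) n with h | h | h
  · obtain ⟨b, hb, rfl⟩ := exists_of_mem_deg_ext hn hV hVn h ha
    obtain ⟨q, hq⟩ := hX k b hb
    exact ⟨q, (toExt hn hV hVn).hom.map_subSucc k q hq⟩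
  · rw [h] at ha
    obtain ⟨b, hb, v, rfl⟩ := exists_of_mem_deg_ext_self hn hV hVn ha
    rw [← h] at hb hX'
    obtain ⟨q, hq⟩ := hX k b hb
    -- The element dv has degree n + 1, but `X` is generated in degrees ≤ n = k + 1, so it lies in
    -- `sub (k + 1)` and hence in some stage.
    obtain ⟨r, hr⟩ := hX.exists_mem_subSucc k (a := (v : X.toCdga × A).1) (hX' ▸ Algebra.mem_top)
    refine ⟨max q (r + 1), add_mem (Cdga.subSucc_mono k (le_max_left _ _)
      ((toExt hn hV hVn).hom.map_subSucc k q hq)) (Cdga.subSucc_mono k (le_max_right _ _)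
      (Algebra.subset_adjoin (Or.inr ?_)))⟩
    have hv : newGen hn hV hVn v ∈ (ext hn hV hVn).toCdga.deg (k + 1) := by
      rw [h]; exact newGen_mem hn hV hVn v
    refine ⟨Cdga.mem_sub le_rfl hv, hv, ?_⟩
    rw [d_newGen]
    exact (toExt hn hV hVn).hom.map_subSucc k r hr
  · refine ⟨0, Cdga.sub_mono (m := n) (by omega) ?_⟩
    rw [sub_ext_eq_top hn hV hVn hX']
    exact Algebra.mem_top

/-- The new generators are a G-stable copy of H^n of the mapping cone. Only kernel classes coming
from `X` are killed: products with new generators may produce further ones. -/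
theorem Pre.step (hG : IsReductive H) (hn : 1 ≤ n) (hX : Pre n X) :
    ∃ (Y : FreeOver A) (α : X ⟶ Y), Pre n Y ∧ SurjH Y n ∧
      ∀ z ∈ X.toCdga.cocycles (n + 1), X.hom.toAlgHom z ∈ A.coboundaries (n + 1) →
        α.hom.toAlgHom z ∈ Y.toCdga.coboundaries (n + 1) := by
  have hn : 1 ≤ (n : ℤ) := by omega
  obtain ⟨V, hV, hVn, hB, hC⟩ := hG.exists_complement (X.toCdga.isRep.prod A.isRep)
    (X.isSubrep_boundaryPairs n) (X.isSubrep_pairs n) (X.boundaryPairs_le n)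
  refine ⟨ext hn hV hVn, toExt hn hV hVn, ⟨?_, ?_, sub_ext_eq_top hn hV hVn hX.generated,
    nilpotent_ext hn hV hVn hX.nilpotent hX.generated,
    fun w hw => adamsPos_ext hn hV hVn hw (hX.adams w hw)⟩, ?_, ?_⟩
  · exact fun m hm => (hX.surj m hm).of_emb (toExt hn hV hVn)
  · intro m hm
    rcases hm.lt_or_eq with hm' | rfl
    · intro z hz hs
      obtain ⟨b, hb, rfl⟩ := exists_of_mem_deg_ext hn hV hVn hm' hz.1
      exact (hX.inj m hm).of_emb (toExt hn hV hVn) hz hs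
    · exact injH_ext hn hV hVn (hX.inj _ le_rfl) hB
  · rintro a ⟨ha, ha'⟩
    have ha' : A.d a = 0 := ha'
    obtain ⟨y, hy, h₁, h₂⟩ := exists_pair hn hV hVn hC (p := (0, a))
      ⟨zero_mem _, ha, map_zero _, by rw [map_zero]; exact ha'⟩
    refine ⟨y, ⟨hy, ?_⟩, h₂⟩
    change (ext hn hV hVn).toCdga.d y = 0
    rw [h₁, map_zero]
  · rintro z ⟨hz, hz'⟩ ⟨a, ha, has⟩
    rw [add_sub_cancel_right] at ha
    obtain ⟨y, hy, h₁, -⟩ := exists_pair hn hV hVn hC (p := (z, a)) ⟨hz, ha, hz', has⟩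
    exact ⟨y, by rwa [add_sub_cancel_right], h₁⟩

end FreeOver

end CdgaOver

namespace CdgaOver

open GradedSym CategoryTheory

variable {H : Type u} [CommRing H] [HopfAlgebra ℚ H]

namespace FreeOver

variable {A : Cdga.{u, v} H}

/-! ### Colimits of sequences -/

section Colimit

variable (F : ℕ ⥤ FreeOver A)

/-- The transition maps of a sequence. -/
def transition (i k : ℕ) (h : i ≤ k) : Emb (F.obj i) (F.obj k) := F.map (homOfLE h)

/-- The transition maps on the generators of degree `n`. -/
abbrev transitionGen (n : ℤ) (i k : ℕ) (h : i ≤ k) : (F.obj i).E n →ₗ[ℚ] (F.obj k).E n :=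
  (transition F i k h).j n

instance (n : ℤ) :
    DirectedSystem (fun k => (F.obj k).E n) (fun i k h => transitionGen F n i k h) where
  map_self i x := by
    have h : transition F i i le_rfl = Emb.id _ := F.map_id i
    rw [transitionGen, h]
    rfl
  map_map l k i hik hkl x := by
    have h : transition F i l (hik.trans hkl) = (transition F i k hik).comp (transition F k l hkl) :=
      F.map_comp (homOfLE hik) (homOfLE hkl)
    rw [transitionGen, transitionGen, transitionGen, h]
    rfl

/-- The generators of the colimit. -/
abbrev ColimGen (n : ℤ) : Type v :=
  Module.DirectLimit (fun k => (F.obj k).E n) (transitionGen F n)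

/-- The maps to the generators of the colimit. -/
abbrev toColimGen (k : ℕ) (n : ℤ) : (F.obj k).E n →ₗ[ℚ] ColimGen F n :=
  Module.DirectLimit.of ℚ ℕ (fun k => (F.obj k).E n) (transitionGen F n) k

theorem toColimGen_comp (n : ℤ) {i k : ℕ} (h : i ≤ k) :
    toColimGen F k n ∘ₗ transitionGen F n i k h = toColimGen F i n :=
  LinearMap.ext fun _ => Module.DirectLimit.of_f

theorem toColimGen_injective (k : ℕ) (n : ℤ) : Function.Injective (toColimGen F k n) := by
  rw [injective_iff_map_eq_zero]
  intro x hx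
  obtain ⟨l, h, hl⟩ := Module.DirectLimit.of.zero_exact hx
  exact (transition F k l h).injective n (hl.trans (map_zero _).symm)

theorem exists_toColimGen {n : ℤ} (x : ColimGen F n) : ∃ k y, toColimGen F k n y = x :=
  Module.DirectLimit.exists_of x

theorem colimRho_compat (n : ℤ) (i k : ℕ) (h : i ≤ k) (x : (F.obj i).E n) :
    ((toColimGen F k n).rTensor H ∘ₗ (F.obj k).ρ n) (transitionGen F n i k h x) =
      ((toColimGen F i n).rTensor H ∘ₗ (F.obj i).ρ n) x := by
  have h₁ := LinearMap.congr_fun ((transition F i k h).equivariant n) x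
  rw [LinearMap.comp_apply, LinearMap.comp_apply] at h₁
  rw [LinearMap.comp_apply, LinearMap.comp_apply, h₁, ← LinearMap.rTensor_comp_apply,
    toColimGen_comp]

/-- The coaction on the generators of the colimit. -/
def colimRho (n : ℤ) : ColimGen F n →ₗ[ℚ] ColimGen F n ⊗[ℚ] H :=
  Module.DirectLimit.lift ℚ ℕ _ _ (fun k => (toColimGen F k n).rTensor H ∘ₗ (F.obj k).ρ n)
    (colimRho_compat F n)

theorem colimRho_comp (k : ℕ) (n : ℤ) : colimRho F n ∘ₗ toColimGen F k n =
    (toColimGen F k n).rTensor H ∘ₗ (F.obj k).ρ n := by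
  apply LinearMap.ext
  intro x
  exact Module.DirectLimit.lift_of (f := transitionGen F n)
    (fun k => (toColimGen F k n).rTensor H ∘ₗ (F.obj k).ρ n) (colimRho_compat F n) x

/-- The differential on the generators of the colimit. -/
def colimD (n : ℤ) : ColimGen F n →ₗ[ℚ] GradedSym (ColimGen F) :=
  Module.DirectLimit.lift ℚ ℕ _ _
    (fun k => (GradedSym.map (toColimGen F k)).toLinearMap ∘ₗ (F.obj k).d n)
    fun i k h x => by
      have h₁ := (transition F i k h).map_d n x
      rw [LinearMap.comp_apply, LinearMap.comp_apply, ← h₁]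
      refine (GradedSym.map_map _ _ _).trans ?_
      congr 2
      funext m
      exact toColimGen_comp F m h

theorem colimD_toColimGen (k : ℕ) (n : ℤ) (x : (F.obj k).E n) :
    colimD F n (toColimGen F k n x) = GradedSym.map (toColimGen F k) ((F.obj k).d n x) :=
  Module.DirectLimit.lift_of _ _ _

theorem colimD_mem (n : ℤ) (x : ColimGen F n) : colimD F n x ∈ deg (ColimGen F) (n + 1) := by
  obtain ⟨k, y, rfl⟩ := exists_toColimGen F x
  rw [colimD_toColimGen]
  exact map_mem_deg _ ((F.obj k).d_mem n y)

/-- The colimit of a sequence, as a free cdga. -/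
def colimCdga : FreeCdga.{u, v} H where
  E := ColimGen F
  subsingleton n hn := by
    refine ⟨fun x y => ?_⟩
    have h (z : ColimGen F n) : z = 0 := by
      obtain ⟨k, y, rfl⟩ := exists_toColimGen F z
      have := (F.obj k).subsingleton n hn
      rw [Subsingleton.elim y 0, map_zero]
    rw [h x, h y]
  ρ := colimRho F
  isRep n := IsRep.of_forall fun x => by
    obtain ⟨k, y, rfl⟩ := exists_toColimGen F x
    exact ⟨_, _, _, _, toColimGen F k n, y, (F.obj k).isRep n, colimRho_comp F k n, rfl⟩
  d := colimD F
  d_mem := colimD_mem F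
  d_d n x := by
    obtain ⟨k, y, rfl⟩ := exists_toColimGen F x
    rw [colimD_toColimGen, ← map_der (toColimGen F k) (hD := (F.obj k).d_mem)
      (fun n x => (colimD_toColimGen F k n x).symm), (F.obj k).d_d, map_zero]
  d_equivariant n := by
    apply LinearMap.ext
    intro x
    obtain ⟨k, y, rfl⟩ := exists_toColimGen F x
    have h₁ := LinearMap.congr_fun (equivariant_comp ((F.obj k).d_equivariant n)
      (coaction_map (toColimGen F k) (fun n => colimRho_comp F k n))) y
    have h₂ : colimD F n ∘ₗ toColimGen F k n =
        (GradedSym.map (toColimGen F k)).toLinearMap ∘ₗ (F.obj k).d n :=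
      LinearMap.ext (colimD_toColimGen F k n)
    rw [← h₂, LinearMap.rTensor_comp, LinearMap.comp_assoc, ← colimRho_comp] at h₁
    exact h₁

/-- The map to `A` on the generators of the colimit. -/
def colimF (n : ℤ) : ColimGen F n →ₗ[ℚ] A :=
  Module.DirectLimit.lift ℚ ℕ _ _ (fun k => (F.obj k).f n)
    fun i k h x => (transition F i k h).f_j n x

theorem colimF_toColimGen (k : ℕ) (n : ℤ) (x : (F.obj k).E n) :
    colimF F n (toColimGen F k n x) = (F.obj k).f n x :=
  Module.DirectLimit.lift_of _ _ _

theorem colimF_mem (n : ℤ) (x : ColimGen F n) : colimF F n x ∈ A.deg n := by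
  obtain ⟨k, y, rfl⟩ := exists_toColimGen F x
  rw [colimF_toColimGen]
  exact (F.obj k).f_mem n y

/-- The colimit of a sequence. -/
def colim : FreeOver A where
  toFreeCdga := colimCdga F
  f := colimF F
  f_mem := colimF_mem F
  f_d n x := by
    obtain ⟨k, y, rfl⟩ := exists_toColimGen F x
    refine Eq.trans ?_ (((F.obj k).f_d n y).trans (congrArg A.d (colimF_toColimGen F k n y).symm))
    refine (congrArg _ (colimD_toColimGen F k n y)).trans ?_
    let s : GradedSym (ColimGen F) →ₐ[ℚ] A :=
      FreeCdga.liftAlgHom (D := colimCdga F) (colimF F) (colimF_mem F)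
    let t : GradedSym (F.obj k).E →ₐ[ℚ] A := FreeCdga.liftAlgHom (F.obj k).f (F.obj k).f_mem
    have h : s.comp (GradedSym.map (toColimGen F k)) = t := by
      apply GradedSym.hom_ext
      intro m z
      rw [AlgHom.comp_apply, GradedSym.map_of]
      exact (FreeCdga.liftAlgHom_gen (D := colimCdga F) (colimF F) (colimF_mem F) m _).trans
        ((colimF_toColimGen F k m z).trans
          (FreeCdga.liftAlgHom_gen (F.obj k).f (F.obj k).f_mem m z).symm)
    exact DFunLike.congr_fun h ((F.obj k).d n y)
  f_equivariant n := by
    apply LinearMap.ext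
    intro x
    obtain ⟨k, y, rfl⟩ := exists_toColimGen F x
    have h₁ := LinearMap.congr_fun ((F.obj k).f_equivariant n) y
    have h₂ : colimF F n ∘ₗ toColimGen F k n = (F.obj k).f n :=
      LinearMap.ext (colimF_toColimGen F k n)
    rw [← h₂, LinearMap.rTensor_comp, LinearMap.comp_assoc, ← colimRho_comp] at h₁
    exact h₁

/-- The maps to the colimit. -/
def toColim (k : ℕ) : Emb (F.obj k) (colim F) where
  j := toColimGen F k
  injective := toColimGen_injective F k
  equivariant := colimRho_comp F k
  map_d n x := (colimD_toColimGen F k n x).symm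
  f_j := colimF_toColimGen F k

theorem toColim_transition {i k : ℕ} (h : i ≤ k) (a : (F.obj i).toCdga) :
    (toColim F k).hom.toAlgHom ((transition F i k h).hom.toAlgHom a) =
      (toColim F i).hom.toAlgHom a := by
  rw [← Emb.comp_hom]
  congr 3
  apply Emb.ext
  funext n
  exact toColimGen_comp F n h

/-- An element involves finitely many generators, so it comes from a finite stage, which can be
chosen as late as desired. -/
theorem exists_toColim (K : ℕ) (a : (colim F).toCdga) :
    ∃ k ≥ K, ∃ b, (toColim F k).hom.toAlgHom b = a := by
  suffices ∃ k b, (toColim F k).hom.toAlgHom b = a by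
    obtain ⟨k, b, rfl⟩ := this
    exact ⟨max k K, le_max_right _ _, _, toColim_transition F (le_max_left k K) b⟩
  have ha : a ∈ Algebra.adjoin ℚ {a : (colim F).toCdga | ∃ n x, (colim F).gen n x = a} := by
    rw [FreeCdga.adjoin_gen]
    exact Algebra.mem_top
  induction ha using Algebra.adjoin_induction with
  | mem x hx =>
    obtain ⟨n, x, rfl⟩ := hx
    obtain ⟨k, y, rfl⟩ := exists_toColimGen F x
    exact ⟨k, _, (toColim F k).hom_gen n y⟩
  | algebraMap r => exact ⟨0, algebraMap ℚ _ r, AlgHom.commutes _ r⟩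
  | add x y _ _ hx hy =>
    obtain ⟨k, b, rfl⟩ := hx
    obtain ⟨l, c, rfl⟩ := hy
    refine ⟨max k l, (transition F k _ (le_max_left k l)).hom.toAlgHom b +
      (transition F l _ (le_max_right k l)).hom.toAlgHom c, ?_⟩
    rw [map_add, toColim_transition, toColim_transition]
  | mul x y _ _ hx hy =>
    obtain ⟨k, b, rfl⟩ := hx
    obtain ⟨l, c, rfl⟩ := hy
    refine ⟨max k l, (transition F k _ (le_max_left k l)).hom.toAlgHom b *
      (transition F l _ (le_max_right k l)).hom.toAlgHom c, ?_⟩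
    rw [map_mul, toColim_transition, toColim_transition]

/-- Injectivity is required from some stage on only; the ∞-minimal model uses this, where H^m is
under control from stage m. -/
theorem injH_colim {K : ℕ} {m : ℤ} (h : ∀ k ≥ K, InjH (F.obj k) m) : InjH (colim F) m := by
  intro z hz hs
  obtain ⟨k, hk, b, rfl⟩ := exists_toColim F K z
  exact (h k hk).of_emb (toColim F k) hz hs

theorem nilpotent_colim (h : ∀ k, (F.obj k).toCdga.Nilpotent) : (colim F).toCdga.Nilpotent := by
  intro n a ha
  obtain ⟨k, -, b, rfl⟩ := exists_toColim F 0 a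
  obtain ⟨q, hq⟩ := h k n b ((toColim F k).mem_deg ha)
  exact ⟨q, (toColim F k).hom.map_subSucc n q hq⟩

theorem sub_colim_eq_top {n : ℤ} (h : ∀ k, (F.obj k).toCdga.sub n = ⊤) :
    (colim F).toCdga.sub n = ⊤ := by
  rw [eq_top_iff]
  intro a _
  obtain ⟨k, -, b, rfl⟩ := exists_toColim F 0 a
  exact (toColim F k).hom.map_sub n (h k ▸ Algebra.mem_top)

theorem adamsPos_colim {w : CentralCocharacter H} (h : ∀ k, AdamsPos w (F.obj k)) :
    AdamsPos w (colim F) := by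
  intro m r hr
  rw [eq_bot_iff]
  intro x hx
  obtain ⟨k, y, rfl⟩ := exists_toColimGen F x
  have hy := mem_adamsPart_of_map w (colimRho_comp F k m) (toColimGen_injective F k m) hx
  rw [h k m r hr, Submodule.mem_bot] at hy
  rw [hy, map_zero]
  exact zero_mem _

end Colimit

/-! ### The construction of the minimal models -/

/-- Iteration of a construction depending on the index. -/
theorem exists_sequence {P : ℕ → FreeOver A → Prop} {Q : ∀ {X Y : FreeOver A}, (X ⟶ Y) → Prop}
    (hstep : ∀ k X, P k X → ∃ (Y : FreeOver A) (α : X ⟶ Y), P (k + 1) Y ∧ Q α)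
    {X : FreeOver A} (hX : P 0 X) :
    ∃ F : ℕ ⥤ FreeOver A, F.obj 0 = X ∧ (∀ k, P k (F.obj k)) ∧
      ∀ k, Q (F.map (homOfLE (Nat.le_add_right k 1))) := by
  choose Y α hP hQ using hstep
  let S : ∀ k, {X : FreeOver A // P k X} := fun k =>
    Nat.rec ⟨X, hX⟩ (fun k Z => ⟨Y k Z.1 Z.2, hP k Z.1 Z.2⟩) k
  let β : ∀ k, (S k).1 ⟶ (S (k + 1)).1 := fun k => α k (S k).1 (S k).2
  refine ⟨Functor.ofSequence β, rfl, fun k => (S k).2, fun k => ?_⟩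
  rw [Functor.ofSequence_map_homOfLE_succ]
  exact hQ k (S k).1 (S k).2

/-- The properties of an `n`-minimal model. -/
structure Good (n : ℕ) (X : FreeOver A) : Prop where
  surj : ∀ m ≤ (n : ℤ), SurjH X m
  inj : ∀ m ≤ (n + 1 : ℤ), InjH X m
  generated : X.toCdga.sub n = ⊤
  nilpotent : X.toCdga.Nilpotent
  adams : ∀ w, A.AdamsConnected w → AdamsPos w X

/-- One application of `Pre.step` gives surjectivity on H^{n+1}. Injectivity on H^{n+2} appears only
in the colimit, where a kernel class of stage k is already exact at stage k + 1. -/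
theorem Good.step (hG : IsReductive H) {n : ℕ} {X : FreeOver A} (hX : Good n X) :
    ∃ (Y : FreeOver A), Nonempty (X ⟶ Y) ∧ Good (n + 1) Y := by
  have hX' : Pre (n + 1) X :=
    { surj := fun m hm => hX.surj m (by push_cast at hm; omega)
      inj := fun m hm => hX.inj m (by push_cast at hm; omega)
      generated := by
        rw [eq_top_iff, ← hX.generated]
        exact Cdga.sub_mono (by push_cast; omega)
      nilpotent := hX.nilpotent
      adams := hX.adams }
  obtain ⟨F, hF, hP, hQ⟩ := exists_sequence (A := A)
    (P := fun k Y => (k = 0 → Y = X) ∧ Pre (n + 1) Y ∧ (1 ≤ k → SurjH Y (n + 1)))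
    (Q := fun {Y Z} (α : Y ⟶ Z) => ∀ z ∈ Y.toCdga.cocycles (n + 2),
      Y.hom.toAlgHom z ∈ A.coboundaries (n + 2) →
        (Emb.hom α).toAlgHom z ∈ Z.toCdga.coboundaries (n + 2))
    (fun k Y hY => by
      obtain ⟨Z, α, h₁, h₂, h₃⟩ := hY.2.1.step hG (by omega)
      refine ⟨Z, α, ⟨by omega, h₁, fun _ => by exact_mod_cast h₂⟩, ?_⟩
      have e : ((n + 1 : ℕ) : ℤ) + 1 = n + 2 := by push_cast; ring
      rw [e] at h₃
      exact h₃)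
    (X := X) ⟨fun _ => rfl, hX', by omega⟩
  subst hF
  refine ⟨colim F, ⟨toColim F 0⟩, ?_, ?_, ?_, ?_, ?_⟩
  · intro m hm
    rcases hm.lt_or_eq with hm | rfl
    · exact ((hP 0).2.1.surj m hm).of_emb (toColim F 0)
    -- Stage 1 is the first where H^{n+1} is known to be surjective; embeddings preserve this.
    · exact_mod_cast ((hP 1).2.2 le_rfl).of_emb (toColim F 1)
  · intro m hm
    rcases hm.lt_or_eq with hm | rfl
    · exact injH_colim F (K := 0) fun k _ => (hP k).2.1.inj m (by omega)
    · have e : ((n + 1 : ℕ) : ℤ) + 1 = n + 2 := by push_cast; ring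
      rw [e]
      intro z hz hs
      obtain ⟨k, -, b, rfl⟩ := exists_toColim F 0 z
      rw [(toColim F k).hom_hom] at hs
      have h := hQ k b ((toColim F k).mem_cocycles hz) hs
      rw [← toColim_transition F (Nat.le_add_right k 1)]
      exact (toColim F (k + 1)).map_coboundaries h
  · exact sub_colim_eq_top F fun k => (hP k).2.1.generated
  · exact nilpotent_colim F fun k => (hP k).2.1.nilpotent
  · exact fun w hw => adamsPos_colim F fun k => (hP k).2.1.adams w hw

theorem Good.isMinimalModel {n : ℕ} {X : FreeOver A} (hX : Good n X) :
    Cdga.IsMinimalModel n X.hom where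
  generalizedNilpotent := ⟨X.isFree, hX.nilpotent.sub_eq⟩
  generated := hX.generated
  bijective m _ hm :=
    ⟨X.hom.mapCohomology_injective m (hX.inj m (by omega)),
      X.hom.mapCohomology_surjective m (hX.surj m hm)⟩
  injective := X.hom.mapCohomology_injective _ (hX.inj _ le_rfl)

variable (A) in
/-- The free cdga without generators. -/
def initial : FreeOver A where
  E _ := PUnit
  subsingleton _ _ := inferInstance
  ρ _ := 0
  isRep _ := ⟨LinearMap.ext fun _ => by simp, LinearMap.ext fun _ => Subsingleton.elim _ _⟩
  d _ := 0
  d_mem _ _ := zero_mem _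
  d_d _ _ := map_zero _
  d_equivariant _ := by simp
  f _ := 0
  f_mem _ _ := zero_mem _
  f_d _ _ := (map_zero (FreeCdga.liftAlgHom _ _)).trans (map_zero A.d).symm
  f_equivariant _ := by simp

theorem adjoin_initial : Algebra.adjoin ℚ {(1 : (initial A).toCdga)} = ⊤ := by
  rw [eq_top_iff, ← (initial A).adjoin_gen, Algebra.adjoin_le_iff]
  rintro _ ⟨n, x, rfl⟩
  have h : x = 0 := rfl
  rw [h, map_zero]
  exact zero_mem _

theorem initial_eq_zero {n : ℤ} (hn : n ≠ 0) {a : (initial A).toCdga}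
    (ha : a ∈ (initial A).toCdga.deg n) : a = 0 := by
  suffices h : a ∈ (initial A).toCdga.deg 0 from Cdga.eq_zero_of_mem_deg hn ha h
  have h₁ : a ∈ Algebra.adjoin ℚ {(1 : (initial A).toCdga)} := by
    rw [adjoin_initial]
    exact Algebra.mem_top
  rw [Algebra.adjoin_singleton_one, Algebra.mem_bot] at h₁
  obtain ⟨q, rfl⟩ := h₁
  rw [Algebra.algebraMap_eq_smul_one]
  exact Submodule.smul_mem _ _ (Cdga.one_mem_deg _)

/-- For ℚ → A, degrees ≤ 0 are cohomological connectedness, and injectivity on H^1 is trivial as ℚ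
has nothing in degree 1. -/
theorem good_initial (hA : A.CohomologicallyConnected) : Good 0 (initial A) where
  surj m hm := surjH_of_nonpos hA _ hm
  inj m hm := by
    rcases hm.lt_or_eq with hm | rfl
    · exact injH_of_nonpos hA _ (by push_cast at hm; omega)
    · intro z hz _
      rw [initial_eq_zero (by simp) hz.1]
      exact zero_mem _
  generated := by
    rw [eq_top_iff, ← adjoin_initial, Algebra.adjoin_le_iff, Set.singleton_subset_iff]
    exact one_mem _
  nilpotent n a ha := by
    rw [initial_eq_zero (by omega) ha]
    exact ⟨0, zero_mem _⟩
  adams _ _ _ _ _ := eq_bot_iff.2 fun _ _ => rfl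

/-- The models for successive n are nested, which is what allows their colimit to be formed. -/
theorem exists_goodSequence (hG : IsReductive H) (hA : A.CohomologicallyConnected) :
    ∃ F : ℕ ⥤ FreeOver A, ∀ n, Good n (F.obj n) := by
  obtain ⟨F, -, h, -⟩ := exists_sequence (A := A) (P := Good) (Q := fun _ => True)
    (fun k X hX => by
      obtain ⟨Y, ⟨α⟩, hY⟩ := hX.step hG
      exact ⟨Y, α, hY, trivial⟩) (good_initial hA)
  exact ⟨F, h⟩

theorem isInftyMinimalModel_colim {F : ℕ ⥤ FreeOver A} (hF : ∀ n, Good n (F.obj n)) :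
    Cdga.IsInftyMinimalModel (colim F).hom where
  generalizedNilpotent :=
    ⟨(colim F).isFree, (nilpotent_colim F fun k => (hF k).nilpotent).sub_eq⟩
  quasiIso m :=
    ⟨(colim F).hom.mapCohomology_injective m
      -- For m < 0 this is stage 0, where `Good` already controls all negative degrees.
      (injH_colim F (K := m.toNat) fun k hk => (hF k).inj m (by omega)),
      (colim F).hom.mapCohomology_surjective m
        (((hF m.toNat).surj m (by omega)).of_emb (toColim F m.toNat))⟩

end FreeOver

end CdgaOver

end

/-- The models are built without reference to `w`; positivity of the Adams degrees of generators is
carried along for every cocharacter making `A` Adams connected. -/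
theorem mainTheorem8 {H : Type u} [CommRing H] [HopfAlgebra ℚ H] [Algebra.FiniteType ℚ H]
    (hG : CdgaOver.IsReductive H) (w : CdgaOver.CentralCocharacter H)
    (A : CdgaOver.Cdga.{u, v} H) (hA : A.CohomologicallyConnected) :
    (∀ n : ℕ, 1 ≤ n → ∃ (M : CdgaOver.Cdga.{u, v} H) (s : CdgaOver.Cdga.Hom M A),
      (A.AdamsConnected w → M.AdamsConnected w) ∧ CdgaOver.Cdga.IsMinimalModel n s) ∧
    ∃ (M : CdgaOver.Cdga.{u, v} H) (s : CdgaOver.Cdga.Hom M A),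
      (A.AdamsConnected w → M.AdamsConnected w) ∧ CdgaOver.Cdga.IsInftyMinimalModel s := by
  obtain ⟨F, hF⟩ := CdgaOver.FreeOver.exists_goodSequence hG hA
  refine ⟨fun n _ => ⟨(F.obj n).toCdga, (F.obj n).hom, fun h => ?_, (hF n).isMinimalModel⟩,
    (CdgaOver.FreeOver.colim F).toCdga, (CdgaOver.FreeOver.colim F).hom, fun h => ?_,
    CdgaOver.FreeOver.isInftyMinimalModel_colim hF⟩
  · exact (F.obj n).adamsConnected w ((hF n).adams w h)
  · exact (CdgaOver.FreeOver.colim F).adamsConnected w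
      (CdgaOver.FreeOver.adamsPos_colim F fun k => (hF k).adams w h)
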